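/- Let $\theta_0,\sigma_0^2\in(0,\infty)$ and let $Z=\{Z(s)\}_{s\in[0,1]}$ be a zero-mean Gaussian process with $\mathrm{cov}(Z(s),Z(t))=\sigma_0^2e^{-\theta_0|s-t|}$. For every $n$ let $s_1^{(n)}<\dots<s_n^{(n)}$ be points of $[0,1]$ (written $s_1<\dots<s_n$). Let $(w_k)_{k\ge1}$ be a fixed sequence of non-negative numbers, not all zero, and let $K=\sup\{k\ge 1: w_k\neq0\}$. For $\psi=(\theta,\sigma^2)\in(0,\infty)^2$ and distinct $s,t\in[0,1]$ put \[ \ell_{t|s}(\psi)=\ln(\sigma^2)+\ln\bigl(1-e^{-2\theta|s-t|}\bigr)+\frac{\{Z(t)-e^{-\theta|s-t|}Z(s)\}^2}{\sigma^2(1-e^{-2\theta|s-t|})}, \qquad pc\ell_n(\psi)=\sum_{i=1}^n\sum_{\substack{j=1\\ j\ne i}}^n w_{|i-j|}\,\ell_{s_j|s_i}(\psi), \] and, for $J\subset(0,\infty)^2$, call any minimizer $\hat\psi_n=(\hat\theta_n,\hat\sigma_n^2)\in\mathrm{argmin}_{\psi\in J}\,pc\ell_n(\psi)$ a weighted pairwise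 conditional maximum likelihood estimator (WPCMLE). Assume that $K<\infty$. Let $0<a\le b<\infty$ and $0<c\le d<\infty$ be fixed, let $J=[a,b]\times[c,d]$, $J=[a,b]\times(0,\infty)$ or $J=(0,\infty)\times[c,d]$, and assume that there is $(\tilde\theta,\tilde\sigma^2)\in J$ with $\tilde\theta\tilde\sigma^2=\theta_0\sigma_0^2$. Then, almost surely, a WPCMLE exists for all sufficiently large $n$, and for every choice of WPCMLEs $\hat\psi_n$ for all large $n$, $\hat\theta_n\hat\sigma_n^2\to\theta_0\sigma_0^2$ as $n\to\infty$. -/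

import Mathlib

open MeasureTheory ProbabilityTheory Filter Topology Set

/-- `Z`, indexed by `[0,1]`, is a zero-mean Gaussian process under `P` with covariance function
`cov (Z s, Z t) = v₀ * exp (-θ₀ * |s - t|)` (the stationary Ornstein-Uhlenbeck process with scale
parameter `θ₀` and variance parameter `v₀`). -/
structure IsStationaryOU {Ω : Type*} [MeasurableSpace Ω] (P : Measure Ω)
    (Z : unitInterval → Ω → ℝ) (θ₀ v₀ : ℝ) : Prop where
  gaussian : IsGaussianProcess Z P
  mean_zero : ∀ t, ∫ ω, Z t ω ∂P = 0
  cov_eq : ∀ s t : unitInterval,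
    covariance (Z s) (Z t) P = v₀ * Real.exp (-θ₀ * |(s : ℝ) - (t : ℝ)|)

/-- The conditional log-likelihood criterion `ℓ_{t|s}(ψ)` at `ψ = (θ, σ²)`, for a realization
`z : [0,1] → ℝ` of the process: `-2` times the logarithm of the conditional density of `z t` given
`z s`, up to an additive constant. -/
noncomputable def condLogLik (z : unitInterval → ℝ) (t s : unitInterval) (ψ : ℝ × ℝ) : ℝ :=
  Real.log ψ.2 + Real.log (1 - Real.exp (-2 * ψ.1 * |(s : ℝ) - (t : ℝ)|))
    + (z t - Real.exp (-ψ.1 * |(s : ℝ) - (t : ℝ)|) * z s) ^ 2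
      / (ψ.2 * (1 - Real.exp (-2 * ψ.1 * |(s : ℝ) - (t : ℝ)|)))

/-- The weighted pairwise conditional log-likelihood
`∑_i ∑_{j ≠ i} w_{i,j} ℓ_{s_j | s_i}(ψ)` with stationary weights `w_{i,j} = w_{|i - j|}`, for `n`
observation points `s`. The value `w 0` is never used. -/
noncomputable def pairCondLogLik (w : ℕ → ℝ) {n : ℕ} (s : Fin n → unitInterval)
    (z : unitInterval → ℝ) (ψ : ℝ × ℝ) : ℝ :=
  ∑ i : Fin n, ∑ j ∈ Finset.univ.filter (fun j : Fin n => j ≠ i),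
    w (Nat.dist (i : ℕ) (j : ℕ)) * condLogLik z (s j) (s i) ψ

/-- `ψ` is a weighted pairwise conditional maximum likelihood estimate over the parameter set `J`:
a global minimizer over `J` of the weighted pairwise conditional log-likelihood criterion. -/
def IsWPCMLE (J : Set (ℝ × ℝ)) (w : ℕ → ℝ) {n : ℕ} (s : Fin n → unitInterval)
    (z : unitInterval → ℝ) (ψ : ℝ × ℝ) : Prop :=
  ψ ∈ J ∧ ∀ φ ∈ J, pairCondLogLik w s z ψ ≤ pairCondLogLik w s z φ

/-! Put G = θ₀σ₀². For two sites at distance h, 1 - e^{-2θh} is close to 2θh, so half the sum of the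
two conditional terms is, to leading order, log(2θσ²h) + Δ²/(2θσ²h), where Δ is the increment of Z.
It sees ψ only through θσ². With x = θσ²/G and Y = Δ²/(2Gh), subtracting the value at a point ψ₀ of
J with product G leaves log x + Y/x - Y. Once the averages of Y at each lag tend to 1 and the
corrections vanish, the weighted sum divided by n behaves like W(log x + 1/x - 1), W = ∑ w_k, which
is positive off x = 1. Hence the parameters whose criterion does not exceed that of ψ₀ have x near 1
(`eventually_sublevel_near`). All minimizers are among them, and they lie in a compact part of J,
which also gives existence.

The averages of Y are compared with those of the squared innovations ξ². By the Markov property,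
innovations over non-overlapping intervals are independent standard normals; lag-k intervals do not
overlap within a residue class modulo k. Since the sites change with n, the strong law comes from
Chernoff bounds and Borel-Cantelli.

No condition on the spacing is needed: corrections carry a factor h, the gaps at lag k add up to at
most k, and the largest ξ² and Z² are almost surely o(n). These estimates need θ ≤ B; if θ ≥ B and
σ² ≥ c, the logarithmic terms alone exceed the criterion at ψ₀ (`le_pairCriterion_of_ge`). -/

/-- A random variable has the standard normal law. -/
abbrev IsStdNormal {Ω : Type*} [MeasurableSpace Ω] (X : Ω → ℝ) (P : Measure Ω) : Prop :=
  HasLaw X (gaussianReal 0 1) P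

/-! ### Concentration of squared normals and Borel-Cantelli -/

lemma integral_exp_mul_sq_sub_one_gaussianReal {t : ℝ} (ht : t < 1 / 2) :
    ∫ x, Real.exp (t * (x ^ 2 - 1)) ∂(gaussianReal 0 1) =
      Real.exp (-t) * (√(1 - 2 * t))⁻¹ := by
  rw [integral_gaussianReal_eq_integral_smul (by norm_num)]
  have h : ∀ x : ℝ, gaussianPDFReal 0 1 x • Real.exp (t * (x ^ 2 - 1)) =
      ((√(2 * Real.pi))⁻¹ * Real.exp (-t)) * Real.exp (-(1 / 2 - t) * x ^ 2) := by
    intro x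
    simp only [gaussianPDFReal, NNReal.coe_one, mul_one, sub_zero, smul_eq_mul]
    rw [mul_assoc, mul_assoc, ← Real.exp_add, ← Real.exp_add]
    congr 2
    ring
  simp_rw [h]
  rw [integral_const_mul, integral_gaussian]
  have h1 : Real.pi / (1 / 2 - t) = (2 * Real.pi) * (1 - 2 * t)⁻¹ := by
    have : (1 - 2 * t) ≠ 0 := by linarith
    have : (1 / 2 - t) ≠ 0 := by linarith
    field_simp
  have h2 : √(2 * Real.pi) ≠ 0 := by positivity
  rw [h1, Real.sqrt_mul (by positivity) (1 - 2 * t)⁻¹, Real.sqrt_inv]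
  generalize √(2 * Real.pi) = r at h2 ⊢
  field_simp

/-- After taking logarithms this is log(1 - 2t) ≥ -2t - 8t². It follows from log y ≥ 1 - 1/y and
1/(1 - 2t) = 1 + 2t + 4t²/(1 - 2t), where 1 - 2t ≥ 1/2. -/
lemma exp_neg_mul_inv_sqrt_le {t : ℝ} (ht : |t| ≤ 1 / 4) :
    Real.exp (-t) * (√(1 - 2 * t))⁻¹ ≤ Real.exp (4 * t ^ 2) := by
  obtain ⟨h1, h2⟩ := abs_le.1 ht
  have hp : 0 < 1 - 2 * t := by linarith
  have hlog : -2 * t - 8 * t ^ 2 ≤ Real.log (1 - 2 * t) := by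
    refine le_trans ?_ (Real.one_sub_inv_le_log_of_pos hp)
    have : (1 - 2 * t)⁻¹ ≤ 1 + 2 * t + 8 * t ^ 2 := by
      rw [inv_le_iff_one_le_mul₀ hp]
      nlinarith [sq_nonneg t, mul_nonneg (sq_nonneg t) (by linarith : 0 ≤ 1 / 4 - t)]
    linarith
  have hs : √(1 - 2 * t) = Real.exp (Real.log (1 - 2 * t) / 2) := by
    rw [Real.sqrt_eq_rpow, Real.rpow_def_of_pos hp]
    ring_nf
  rw [hs, ← Real.exp_neg, ← Real.exp_add]
  apply Real.exp_le_exp.2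
  linarith

section Chernoff

variable {Ω : Type*} [MeasurableSpace Ω] {P : Measure Ω}

lemma IsStdNormal.mgf_sq_sub_one {X : Ω → ℝ} (hX : IsStdNormal X P) {t : ℝ} (ht : t < 1 / 2) :
    mgf (fun ω => X ω ^ 2 - 1) P t = Real.exp (-t) * (√(1 - 2 * t))⁻¹ := by
  rw [← integral_exp_mul_sq_sub_one_gaussianReal ht, mgf]
  exact hX.integral_comp (f := fun x => Real.exp (t * (x ^ 2 - 1))) (by fun_prop)

/-- The integral of a non-integrable function is 0 by convention, so a positive value certifies
integrability. -/
lemma integrable_exp_of_mgf_pos {X : Ω → ℝ} {t : ℝ} (h : 0 < mgf X P t) :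
    Integrable (fun ω => Real.exp (t * X ω)) P := by
  by_contra hn
  exact h.ne' (integral_undef hn)

lemma measureReal_abs_sum_sq_sub_one_ge [IsProbabilityMeasure P] {ι : Type*} [Fintype ι]
    {X : ι → Ω → ℝ} (hX : ∀ i, IsStdNormal (X i) P) (hind : iIndepFun X P) {n : ℕ}
    (hn : Fintype.card ι ≤ n) {ε : ℝ} (hε : 0 ≤ ε) (hε2 : ε ≤ 2) :
    P.real {ω | ε * n ≤ |∑ i, (X i ω ^ 2 - 1)|} ≤ 2 * Real.exp (-(ε ^ 2 / 16) * n) := by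
  set Y : ι → Ω → ℝ := fun i ω => X i ω ^ 2 - 1 with hY
  have hindY : iIndepFun Y P :=
    hind.comp (fun _ x => x ^ 2 - 1) (fun _ => by fun_prop)
  have hYm : ∀ i, AEMeasurable (Y i) P := fun i => by
    have := (hX i).aemeasurable
    simp only [hY]
    fun_prop
  have key : ∀ t : ℝ, |t| ≤ 1 / 4 → 0 < mgf (∑ i, Y i) P t ∧
      mgf (∑ i, Y i) P t ≤ Real.exp (4 * t ^ 2 * n) := by
    intro t ht
    have h1 := (abs_le.1 ht).2
    have hval : ∀ i, mgf (Y i) P t = Real.exp (-t) * (√(1 - 2 * t))⁻¹ := fun i =>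
      (hX i).mgf_sq_sub_one (by linarith)
    have hpos : 0 < Real.exp (-t) * (√(1 - 2 * t))⁻¹ :=
      mul_pos (Real.exp_pos _) (inv_pos.2 (Real.sqrt_pos.2 (by linarith)))
    rw [hindY.mgf_sum₀ hYm]
    simp only [hval, Finset.prod_const, Finset.card_univ]
    refine ⟨pow_pos hpos _, ?_⟩
    calc (Real.exp (-t) * (√(1 - 2 * t))⁻¹) ^ Fintype.card ι
        ≤ Real.exp (4 * t ^ 2) ^ Fintype.card ι :=
          pow_le_pow_left₀ hpos.le (exp_neg_mul_inv_sqrt_le ht) _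
      _ ≤ Real.exp (4 * t ^ 2) ^ n :=
          pow_le_pow_right₀ (Real.one_le_exp (by positivity)) hn
      _ = Real.exp (4 * t ^ 2 * n) := by rw [← Real.exp_nat_mul]; ring_nf
  -- The choice t = ±ε/8 minimizes the Chernoff exponent -|t|εn + 4t²n, with value -ε²n/16; ε ≤ 2
  -- keeps |t| ≤ 1/4.
  have ht1 : |ε / 8| ≤ 1 / 4 := by rw [abs_of_nonneg (by linarith)]; linarith
  have ht2 : |-(ε / 8)| ≤ 1 / 4 := by rwa [abs_neg]
  have up : P.real {ω | ε * n ≤ (∑ i, Y i) ω} ≤ Real.exp (-(ε ^ 2 / 16) * n) := by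
    refine (measure_ge_le_exp_mul_mgf (t := ε / 8) (ε * n) (by linarith)
      (integrable_exp_of_mgf_pos (key _ ht1).1)).trans ?_
    refine (mul_le_mul_of_nonneg_left (key _ ht1).2 (Real.exp_pos _).le).trans ?_
    rw [← Real.exp_add]
    apply Real.exp_le_exp.2
    apply le_of_eq
    ring
  have lo : P.real {ω | (∑ i, Y i) ω ≤ -(ε * n)} ≤ Real.exp (-(ε ^ 2 / 16) * n) := by
    refine (measure_le_le_exp_mul_mgf (t := -(ε / 8)) (-(ε * n)) (by linarith)
      (integrable_exp_of_mgf_pos (key _ ht2).1)).trans ?_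
    refine (mul_le_mul_of_nonneg_left (key _ ht2).2 (Real.exp_pos _).le).trans ?_
    rw [← Real.exp_add]
    apply Real.exp_le_exp.2
    apply le_of_eq
    ring
  calc P.real {ω | ε * n ≤ |∑ i, (X i ω ^ 2 - 1)|}
      ≤ P.real ({ω | ε * n ≤ (∑ i, Y i) ω} ∪ {ω | (∑ i, Y i) ω ≤ -(ε * n)}) := by
        refine measureReal_mono ?_
        intro ω hω
        simp only [mem_ofPred_eq, mem_union, Finset.sum_apply, hY] at hω ⊢
        rcases le_abs.1 hω with h | h
        · exact Or.inl h
        · exact Or.inr (by linarith)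
    _ ≤ _ := measureReal_union_le _ _
    _ ≤ _ := by linarith

lemma IsStdNormal.measureReal_sq_ge [IsProbabilityMeasure P] {X : Ω → ℝ} (hX : IsStdNormal X P)
    (c : ℝ) : P.real {ω | c ≤ X ω ^ 2} ≤ 2 * Real.exp (-(c / 4)) := by
  have hm := hX.mgf_sq_sub_one (t := 1 / 4) (by norm_num)
  have hle := exp_neg_mul_inv_sqrt_le (t := 1 / 4) (by rw [abs_of_pos (by norm_num)])
  have hpos : 0 < mgf (fun ω => X ω ^ 2 - 1) P (1 / 4) := by
    rw [hm]
    exact mul_pos (Real.exp_pos _) (inv_pos.2 (Real.sqrt_pos.2 (by norm_num)))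
  have h := measure_ge_le_exp_mul_mgf (t := 1 / 4) (c - 1) (by norm_num)
    (integrable_exp_of_mgf_pos hpos)
  rw [← hm] at hle
  have hset : {ω | c - 1 ≤ X ω ^ 2 - 1} = {ω | c ≤ X ω ^ 2} := by
    ext ω
    simp
  rw [hset] at h
  refine h.trans ((mul_le_mul_of_nonneg_left hle (Real.exp_pos _).le).trans ?_)
  rw [← Real.exp_add]
  have h2 : Real.exp (1 / 2) ≤ 2 := by
    have h3 := Real.exp_bound_div_one_sub_of_interval (x := 1 / 2) (by norm_num) (by norm_num)
    norm_num at h3 ⊢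
    exact h3
  calc Real.exp (-(1 / 4) * (c - 1) + 4 * (1 / 4) ^ 2)
      = Real.exp (1 / 2) * Real.exp (-(c / 4)) := by rw [← Real.exp_add]; ring_nf
    _ ≤ _ := mul_le_mul_of_nonneg_right h2 (Real.exp_pos _).le

lemma ae_eventually_not_of_summable [IsFiniteMeasure P] {p : ℕ → Ω → Prop} {b : ℕ → ℝ}
    (hb : Summable b) (h : ∀ n, P.real {ω | p n ω} ≤ b n) :
    ∀ᵐ ω ∂P, ∀ᶠ n in atTop, ¬ p n ω := by
  have hb0 : ∀ n, 0 ≤ b n := fun n => measureReal_nonneg.trans (h n)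
  have : (∑' n, P {ω | p n ω}) ≠ ⊤ := by
    refine ne_top_of_le_ne_top hb.tsum_ofReal_ne_top (ENNReal.tsum_le_tsum fun n => ?_)
    rw [← ofReal_measureReal]
    exact ENNReal.ofReal_le_ofReal (h n)
  exact ae_eventually_notMem this

lemma summable_exp_neg_mul_nat {c : ℝ} (hc : 0 < c) (k : ℕ) :
    Summable fun n : ℕ => (n : ℝ) ^ k * Real.exp (-c * n) := by
  simpa using Real.summable_pow_mul_exp_neg_nat_mul k hc

/-- Monotonicity in ε lets the countable family ε = 1/(m + 1) control all ε, so the null sets can be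
united. -/
lemma ae_forall_eventually_of_forall {q : ℝ → ℕ → Ω → Prop}
    (hmono : ∀ ε ε' n ω, ε ≤ ε' → q ε n ω → q ε' n ω)
    (h : ∀ ε, 0 < ε → ε ≤ 2 → ∀ᵐ ω ∂P, ∀ᶠ n in atTop, q ε n ω) :
    ∀ᵐ ω ∂P, ∀ ε, 0 < ε → ∀ᶠ n in atTop, q ε n ω := by
  have h' : ∀ m : ℕ, ∀ᵐ ω ∂P, ∀ᶠ n in atTop, q (1 / ((m : ℝ) + 1)) n ω := fun m =>
    h _ (by positivity) (by
      rw [div_le_iff₀ (by positivity)]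
      have : (0 : ℝ) ≤ m := Nat.cast_nonneg m
      linarith)
  filter_upwards [ae_all_iff.2 h'] with ω hω ε hε
  obtain ⟨m, hm⟩ := exists_nat_one_div_lt hε
  exact (hω m).mono fun n hn => hmono _ _ _ _ hm.le hn

/-- Strong law of large numbers for the squares of the rows of a triangular array of independent
standard normal variables. -/
lemma ae_tendsto_sum_sq_sub_one_div [IsProbabilityMeasure P] {X : ℕ → ℕ → Ω → ℝ}
    {I : ℕ → Finset ℕ} (hI : ∀ n, (I n).card ≤ n)
    (hX : ∀ n, ∀ i ∈ I n, IsStdNormal (X n i) P)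
    (hind : ∀ n, iIndepFun (fun i : I n => X n i) P) :
    ∀ᵐ ω ∂P, Tendsto (fun n : ℕ => (∑ i ∈ I n, (X n i ω ^ 2 - 1)) / (n : ℝ)) atTop (𝓝 0) := by
  have h := ae_forall_eventually_of_forall (P := P)
    (q := fun ε n ω => |∑ i ∈ I n, (X n i ω ^ 2 - 1)| ≤ ε * n)
    (fun ε ε' n ω hε hq => hq.trans (by gcongr)) ?_
  · filter_upwards [h] with ω hω
    rw [Metric.tendsto_atTop']
    intro ε hε
    obtain ⟨N, hN⟩ := eventually_atTop.1 (hω (ε / 2) (by linarith))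
    refine ⟨N, fun n hn => ?_⟩
    have hn0 : (0 : ℝ) < n := by
      exact_mod_cast lt_of_le_of_lt (Nat.zero_le N) hn
    rw [Real.dist_eq, sub_zero, abs_div, abs_of_pos hn0, div_lt_iff₀ hn0]
    have := hN n hn.le
    nlinarith
  · intro ε hε hε2
    have hs : Summable fun n : ℕ => 2 * Real.exp (-(ε ^ 2 / 16) * n) := by
      simpa using (summable_exp_neg_mul_nat (c := ε ^ 2 / 16) (by positivity) 0).mul_left 2
    have hb := ae_eventually_not_of_summable (P := P)
      (p := fun n ω => ε * n ≤ |∑ i ∈ I n, (X n i ω ^ 2 - 1)|) hs fun n => by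
        have := measureReal_abs_sum_sq_sub_one_ge (P := P) (X := fun i : I n => X n i)
          (fun i => hX n i i.2) (hind n) (n := n) (by simpa using hI n) hε.le hε2
        simpa only [Finset.univ_eq_attach,
          fun ω => Finset.sum_attach (I n) (fun i => X n i ω ^ 2 - 1)] using this
    filter_upwards [hb] with ω hω
    exact hω.mono fun n hn => (not_le.1 hn).le

/-- In a triangular array of standard normal variables, the largest square of the `n`-th row is
almost surely `o(n)`. -/
lemma ae_eventually_sq_le [IsProbabilityMeasure P] {X : ℕ → ℕ → Ω → ℝ}
    {I : ℕ → Finset ℕ} (hI : ∀ n, (I n).card ≤ n)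
    (hX : ∀ n, ∀ i ∈ I n, IsStdNormal (X n i) P) :
    ∀ᵐ ω ∂P, ∀ ε, 0 < ε → ∀ᶠ n : ℕ in atTop, ∀ i ∈ I n, X n i ω ^ 2 ≤ ε * n := by
  refine ae_forall_eventually_of_forall (P := P)
    (q := fun ε n ω => ∀ i ∈ I n, X n i ω ^ 2 ≤ ε * n) (fun ε ε' n ω hε hq i hi => (hq i hi).trans (by gcongr)) ?_
  intro ε hε _
  -- The factor n is the cost of a union bound over the row; no independence is needed.
  have hs : Summable fun n : ℕ => 2 * ((n : ℝ) ^ 1 * Real.exp (-(ε / 4) * n)) :=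
    (summable_exp_neg_mul_nat (by positivity) 1).mul_left 2
  have hb := ae_eventually_not_of_summable (P := P)
    (p := fun n ω => ∃ i ∈ I n, ε * (n : ℝ) ≤ X n i ω ^ 2) hs fun n => by
      calc P.real {ω | ∃ i ∈ I n, ε * (n : ℝ) ≤ X n i ω ^ 2}
          = P.real (⋃ i ∈ I n, {ω | ε * (n : ℝ) ≤ X n i ω ^ 2}) := by
            congr 1
            ext ω
            simp only [mem_ofPred_eq, mem_iUnion, exists_prop]
        _ ≤ ∑ i ∈ I n, P.real {ω | ε * (n : ℝ) ≤ X n i ω ^ 2} :=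
            measureReal_biUnion_finset_le (I n) fun i => {ω | ε * n ≤ X n i ω ^ 2}
        _ ≤ ∑ i ∈ I n, 2 * Real.exp (-(ε * (n : ℝ) / 4)) :=
            Finset.sum_le_sum fun i hi => IsStdNormal.measureReal_sq_ge (hX n i hi) (ε * n)
        _ = (I n).card * (2 * Real.exp (-(ε * n / 4))) := by simp
        _ ≤ n * (2 * Real.exp (-(ε * n / 4))) := by
            gcongr
            exact_mod_cast hI n
        _ = _ := by ring_nf
  filter_upwards [hb] with ω hω
  refine hω.mono fun n hn i hi => ?_
  by_contra hcon
  exact hn ⟨i, hi, (not_le.1 hcon).le⟩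

end Chernoff

/-! ### Innovations of the Ornstein-Uhlenbeck process -/

/-- The standardized innovation of the Ornstein-Uhlenbeck process between two times: the residual
of the regression of `z t` on `z s`, divided by its standard deviation. -/
noncomputable def innovation (θ v : ℝ) (z : unitInterval → ℝ) (p : unitInterval × unitInterval) :
    ℝ :=
  (z p.2 - Real.exp (-θ * ((p.2 : ℝ) - p.1)) * z p.1)
    / √(v * (1 - Real.exp (-2 * θ * ((p.2 : ℝ) - p.1))))

lemma tendsto_natCast_sub_div (k : ℕ) :
    Tendsto (fun n : ℕ => ((n - k : ℕ) : ℝ) / n) atTop (𝓝 1) := by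
  have h1 : Tendsto (fun n : ℕ => 1 - (k : ℝ) / n) atTop (𝓝 1) := by
    simpa using tendsto_const_nhds.sub (tendsto_const_div_atTop_nhds_zero_nat (k : ℝ))
  refine h1.congr' ?_
  filter_upwards [eventually_ge_atTop k, eventually_gt_atTop 0] with n hn hn0
  have : (n : ℝ) ≠ 0 := by positivity
  rw [Nat.cast_sub hn]
  field_simp

namespace IsStationaryOU

variable {Ω : Type*} [MeasurableSpace Ω] {P : Measure Ω}
  {Z : unitInterval → Ω → ℝ} {θ v : ℝ}

/-- Each innovation is linear in two coordinates of Z, so the family is jointly Gaussian. This is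
what later turns zero covariance into independence. -/
lemma isGaussianProcess_innovation (hZ : IsStationaryOU P Z θ v) :
    IsGaussianProcess (fun p ω => innovation θ v (fun t => Z t ω) p) P := by
  classical
  refine hZ.gaussian.of_isGaussianProcess fun p => ⟨{p.1, p.2}, ?_⟩
  let L₁ : (({p.1, p.2} : Finset unitInterval) → ℝ) →L[ℝ] ℝ :=
    ContinuousLinearMap.proj ⟨p.1, by simp⟩
  let L₂ : (({p.1, p.2} : Finset unitInterval) → ℝ) →L[ℝ] ℝ :=
    ContinuousLinearMap.proj ⟨p.2, by simp⟩
  refine ⟨(√(v * (1 - Real.exp (-2 * θ * ((p.2 : ℝ) - p.1)))))⁻¹ •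
    (L₂ - Real.exp (-θ * ((p.2 : ℝ) - p.1)) • L₁), fun ω => ?_⟩
  simp [L₁, L₂, innovation, div_eq_inv_mul]

lemma covariance_of_le (hZ : IsStationaryOU P Z θ v) {s t : unitInterval} (h : s ≤ t) :
    covariance (Z s) (Z t) P = v * Real.exp (-θ * ((t : ℝ) - s)) := by
  have h' : (s : ℝ) ≤ t := h
  rw [hZ.cov_eq, abs_sub_comm, abs_of_nonneg (by linarith)]

lemma integral_innovation (hZ : IsStationaryOU P Z θ v) (p : unitInterval × unitInterval) :
    ∫ ω, innovation θ v (fun t => Z t ω) p ∂P = 0 := by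
  have hi : ∀ t, Integrable (Z t) P := fun t => (hZ.gaussian.hasGaussianLaw_eval t).integrable
  simp only [innovation]
  rw [integral_div, integral_sub (hi _) ((hi _).const_mul _), integral_const_mul,
    hZ.mean_zero, hZ.mean_zero]
  simp

lemma covariance_innovation [IsProbabilityMeasure P] (hZ : IsStationaryOU P Z θ v) (p q : unitInterval × unitInterval) :
    covariance (fun ω => innovation θ v (fun t => Z t ω) p)
      (fun ω => innovation θ v (fun t => Z t ω) q) P =
    ((covariance (Z p.2) (Z q.2) P
      - Real.exp (-θ * ((q.2 : ℝ) - q.1)) * covariance (Z p.2) (Z q.1) P)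
      - Real.exp (-θ * ((p.2 : ℝ) - p.1)) * (covariance (Z p.1) (Z q.2) P
      - Real.exp (-θ * ((q.2 : ℝ) - q.1)) * covariance (Z p.1) (Z q.1) P))
      / √(v * (1 - Real.exp (-2 * θ * ((p.2 : ℝ) - p.1))))
      / √(v * (1 - Real.exp (-2 * θ * ((q.2 : ℝ) - q.1)))) := by
  have hm : ∀ t, MemLp (Z t) 2 P := fun t => (hZ.gaussian.hasGaussianLaw_eval t).memLp_two
  have hc : ∀ (t : unitInterval) (c : ℝ), MemLp (fun ω => c * Z t ω) 2 P :=
    fun t c => (hm t).const_mul c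
  simp only [innovation]
  rw [covariance_fun_div_left, covariance_fun_div_right,
    covariance_fun_sub_fun_sub (hm _) (hc _ _) (hm _) (hc _ _),
    covariance_const_mul_left, covariance_const_mul_left, covariance_const_mul_right,
    covariance_const_mul_right]
  ring

lemma isStdNormal_innovation [IsProbabilityMeasure P] (hZ : IsStationaryOU P Z θ v) (hθ : 0 < θ) (hv : 0 < v)
    {s t : unitInterval} (hst : s < t) :
    IsStdNormal (fun ω => innovation θ v (fun t => Z t ω) (s, t)) P := by
  have hg := hZ.isGaussianProcess_innovation.hasGaussianLaw_eval (s, t)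
  refine ⟨hg.aemeasurable, ?_⟩
  have hst' : (0 : ℝ) < t - s := sub_pos.2 hst
  have hpos : 0 < v * (1 - Real.exp (-2 * θ * ((t : ℝ) - s))) := by
    refine mul_pos hv (sub_pos.2 (Real.exp_lt_one_iff.2 ?_))
    nlinarith [mul_pos hθ hst']
  have hvar : variance (fun ω => innovation θ v (fun t => Z t ω) (s, t)) P = 1 := by
    rw [← covariance_self hg.aemeasurable, hZ.covariance_innovation,
      hZ.covariance_of_le le_rfl, hZ.covariance_of_le le_rfl, hZ.covariance_of_le hst.le,
      covariance_comm, hZ.covariance_of_le hst.le, div_div, Real.mul_self_sqrt hpos.le,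
      div_eq_one_iff_eq hpos.ne']
    have h2 : Real.exp (-2 * θ * ((t : ℝ) - s)) =
        Real.exp (-θ * ((t : ℝ) - s)) * Real.exp (-θ * ((t : ℝ) - s)) := by
      rw [← Real.exp_add]; ring_nf
    simp only [sub_self, mul_zero, Real.exp_zero]
    rw [h2]
    ring
  rw [hg.map_eq_gaussianReal, hZ.integral_innovation, hvar]
  simp

/-- Markov property: e^{-θ(d - x)} = e^{-θ(d - c)} e^{-θ(c - x)}, so the residual of Z at d given c
is uncorrelated with Z at every x ≤ c, in particular at a and b. -/
lemma covariance_innovation_eq_zero [IsProbabilityMeasure P] (hZ : IsStationaryOU P Z θ v) {a b c d : unitInterval}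
    (hab : a < b) (hbc : b ≤ c) (hcd : c < d) :
    covariance (fun ω => innovation θ v (fun t => Z t ω) (a, b))
      (fun ω => innovation θ v (fun t => Z t ω) (c, d)) P = 0 := by
  rw [hZ.covariance_innovation, hZ.covariance_of_le (hbc.trans hcd.le), hZ.covariance_of_le hbc,
    hZ.covariance_of_le (hab.le.trans (hbc.trans hcd.le)), hZ.covariance_of_le (hab.le.trans hbc)]
  have h : ∀ x : ℝ, v * Real.exp (-θ * ((d : ℝ) - x)) -
      Real.exp (-θ * ((d : ℝ) - c)) * (v * Real.exp (-θ * ((c : ℝ) - x))) = 0 := by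
    intro x
    rw [mul_left_comm, ← Real.exp_add]
    ring_nf
  simp only [h, mul_zero, sub_zero, zero_div]

lemma isStdNormal_div_sqrt [IsProbabilityMeasure P] (hZ : IsStationaryOU P Z θ v) (hv : 0 < v) (t : unitInterval) :
    IsStdNormal (fun ω => Z t ω / √v) P := by
  have hg : HasGaussianLaw (fun ω => (√v)⁻¹ • Z t ω) P :=
    (hZ.gaussian.hasGaussianLaw_eval t).fun_smul (√v)⁻¹
  have he : (fun ω => (√v)⁻¹ • Z t ω) = fun ω => Z t ω / √v := by
    ext ω
    simp [div_eq_inv_mul]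
  rw [he] at hg
  refine ⟨hg.aemeasurable, ?_⟩
  have hvar : variance (fun ω => Z t ω / √v) P = 1 := by
    rw [← covariance_self hg.aemeasurable, covariance_fun_div_left, covariance_fun_div_right,
      hZ.covariance_of_le le_rfl, div_div, Real.mul_self_sqrt hv.le]
    simp [hv.ne']
  rw [hg.map_eq_gaussianReal, integral_div, hZ.mean_zero, hvar]
  simp

/-- The lag-`k` innovations along sites whose indices are congruent modulo `k` are independent. -/
lemma iIndepFun_innovation [IsProbabilityMeasure P] (hZ : IsStationaryOU P Z θ v) {k : ℕ} (hk : 0 < k)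
    {I : Finset ℕ} {r : ℕ} (hr : ∀ i ∈ I, i % k = r) {T : ℕ → unitInterval}
    (hT : StrictMonoOn T {i | i ∈ I ∨ ∃ j ∈ I, i = j + k}) :
    iIndepFun (fun (i : I) ω => innovation θ v (fun t => Z t ω) (T i, T (i + k))) P := by
  have hlt : ∀ i ∈ I, ∀ j ∈ I, i < j → covariance
      (fun ω => innovation θ v (fun t => Z t ω) (T i, T (i + k)))
      (fun ω => innovation θ v (fun t => Z t ω) (T j, T (j + k))) P = 0 := by
    intro i hi j hj hij
    -- Distinct indices congruent modulo k differ by at least k, so the two intervals share at most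
    -- an endpoint.
    have hle : i + k ≤ j := by
      have hmod : i ≡ j [MOD k] := (hr i hi).trans (hr j hj).symm
      have := Nat.le_of_dvd (by omega) ((Nat.modEq_iff_dvd' hij.le).1 hmod)
      omega
    exact hZ.covariance_innovation_eq_zero (hT (.inl hi) (.inr ⟨i, hi, rfl⟩) (by omega))
      (hT.monotoneOn (.inr ⟨i, hi, rfl⟩) (.inl hj) hle) (hT (.inl hj) (.inr ⟨j, hj, rfl⟩) (by omega))
  refine HasGaussianLaw.iIndepFun_of_covariance_eq_zero ?_ ?_
  · have h := hZ.isGaussianProcess_innovation.comp_right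
      (fun i : I => (T i, T (i + k)))
    let L : (↥(Finset.univ : Finset I) → ℝ) →L[ℝ] (I → ℝ) :=
      ContinuousLinearMap.pi fun i => ContinuousLinearMap.proj ⟨i, Finset.mem_univ i⟩
    exact (h.hasGaussianLaw Finset.univ).map L
  · intro i j hij
    rcases lt_or_gt_of_ne (fun h => hij (Subtype.ext h)) with h | h
    · exact hlt i i.2 j j.2 h
    · rw [covariance_comm]
      exact hlt j j.2 i i.2 h

/-- Strong law of large numbers for the squared lag-`k` innovations along a triangular array of
sites. -/
lemma ae_tendsto_sum_innovation_sq [IsProbabilityMeasure P] (hZ : IsStationaryOU P Z θ v) (hθ : 0 < θ) (hv : 0 < v)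
    {T : ℕ → ℕ → unitInterval} (hT : ∀ n, StrictMonoOn (T n) (Iio n)) {k : ℕ} (hk : 0 < k) :
    ∀ᵐ ω ∂P, Tendsto (fun n : ℕ => (∑ i ∈ Finset.range (n - k),
      innovation θ v (fun t => Z t ω) (T n i, T n (i + k)) ^ 2) / (n : ℝ)) atTop (𝓝 1) := by
  have hres : ∀ r : ℕ, ∀ᵐ ω ∂P, Tendsto (fun n : ℕ =>
      (∑ i ∈ (Finset.range (n - k)).filter (fun i => i % k = r),
        (innovation θ v (fun t => Z t ω) (T n i, T n (i + k)) ^ 2 - 1)) / (n : ℝ))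
      atTop (𝓝 0) := by
    intro r
    refine ae_tendsto_sum_sq_sub_one_div
      (X := fun n i ω => innovation θ v (fun t => Z t ω) (T n i, T n (i + k))) ?_ ?_ ?_
    · intro n
      refine (Finset.card_filter_le _ _).trans ?_
      simp
    · intro n i hi
      simp only [Finset.mem_filter, Finset.mem_range] at hi
      exact hZ.isStdNormal_innovation hθ hv
        (hT n (mem_Iio.2 (by omega)) (mem_Iio.2 (by omega)) (by omega))
    · intro n
      refine hZ.iIndepFun_innovation hk (r := r) ?_ ((hT n).mono ?_)
      · intro i hi
        exact (Finset.mem_filter.1 hi).2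
      · rintro i (hi | ⟨j, hj, rfl⟩)
        · simp only [Finset.mem_filter, Finset.mem_range] at hi
          exact mem_Iio.2 (by omega)
        · simp only [Finset.mem_filter, Finset.mem_range] at hj
          exact mem_Iio.2 (by omega)
  filter_upwards [ae_all_iff.2 hres] with ω hω
  -- The centred sums over the k residue classes are recombined; the removed constants contribute (n
  -- - k)/n, which supplies the limit 1.
  have hsum := tendsto_finsetSum (Finset.range k) fun r _ => hω r
  have h := hsum.add (tendsto_natCast_sub_div k)
  simp only [Finset.sum_const_zero, zero_add] at h
  refine h.congr fun n => ?_
  rw [← Finset.sum_div, ← add_div, Finset.sum_fiberwise_of_maps_to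
    (fun i _ => Finset.mem_range.2 (Nat.mod_lt i hk)), Finset.sum_sub_distrib]
  simp

end IsStationaryOU

/-! ### Deterministic bounds for one pair of sites -/

/-- The sum of the two conditional criteria of a pair of sites at distance `h`, where the field
takes the values `x` and `y`. -/
noncomputable def pairCriterion (h x y : ℝ) (ψ : ℝ × ℝ) : ℝ :=
  2 * (Real.log ψ.2 + Real.log (1 - Real.exp (-2 * ψ.1 * h)))
    + ((x - Real.exp (-ψ.1 * h) * y) ^ 2 + (y - Real.exp (-ψ.1 * h) * x) ^ 2)
      / (ψ.2 * (1 - Real.exp (-2 * ψ.1 * h)))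

section Pair

lemma one_sub_exp_pos {u : ℝ} (hu : 0 < u) : 0 < 1 - Real.exp (-u) :=
  sub_pos.2 (Real.exp_lt_one_iff.2 (by linarith))

/-- This is u ≤ sinh u multiplied by 2e^{-u}. -/
lemma two_mul_exp_neg_le_one_sub_exp {u : ℝ} (hu : 0 ≤ u) :
    2 * u * Real.exp (-u) ≤ 1 - Real.exp (-(2 * u)) := by
  have h := Real.self_le_sinh_iff.2 hu
  rw [Real.sinh_eq] at h
  have h1 : Real.exp u * Real.exp (-u) = 1 := by rw [← Real.exp_add]; simp
  have h2 : Real.exp (-(2 * u)) = Real.exp (-u) * Real.exp (-u) := by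
    rw [← Real.exp_add]; ring_nf
  rw [h2]
  nlinarith [Real.exp_pos (-u)]

lemma one_sub_exp_le (u : ℝ) : 1 - Real.exp (-u) ≤ u := by
  linarith [Real.add_one_le_exp (-u)]

lemma log_two_mul_sub_le_log_one_sub_exp {u : ℝ} (hu : 0 < u) :
    Real.log (2 * u) - u ≤ Real.log (1 - Real.exp (-(2 * u))) := by
  have h := Real.log_le_log (by positivity) (two_mul_exp_neg_le_one_sub_exp hu.le)
  rwa [Real.log_mul (by positivity) (Real.exp_ne_zero _), Real.log_exp, ← sub_eq_add_neg] at h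

/-- Isolates the squared increment. With ρ = e^{-θh} the remainder carries (1 - ρ)² = O(h²), hence
is only O(h) after division by 1 - ρ². -/
lemma pair_quadratic_eq (x y ρ : ℝ) :
    (x - ρ * y) ^ 2 + (y - ρ * x) ^ 2 =
      2 * ρ * (y - x) ^ 2 + (1 - ρ) ^ 2 * (x ^ 2 + y ^ 2) := by
  ring

lemma exp_neg_two_mul_mul (θ h : ℝ) : Real.exp (-2 * θ * h) = Real.exp (-(2 * (θ * h))) := by
  ring_nf

variable {h x y : ℝ} {ψ : ℝ × ℝ}

/-- The nonnegative remainder of `pair_quadratic_eq` is dropped, and e^{-u} ≥ 1 - u, 1 - e^{-2u} ≤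
2u are used with u = θh. Only the corrections in θh fail to depend on ψ through its product, hence
the later need to bound θ. -/
lemma le_pairCriterion (hh : 0 < h) (h1 : 0 < ψ.1) (h2 : 0 < ψ.2) :
    Real.log (2 * (ψ.1 * ψ.2) * h) - ψ.1 * h
      + (y - x) ^ 2 / (2 * (ψ.1 * ψ.2) * h) * (1 - ψ.1 * h) ≤ pairCriterion h x y ψ / 2 := by
  obtain ⟨θ, σ⟩ := ψ
  simp only at h1 h2
  have hu : 0 < θ * h := mul_pos h1 hh
  have hq : 0 < 1 - Real.exp (-(2 * (θ * h))) := one_sub_exp_pos (by positivity)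
  have hlog : Real.log (2 * (θ * σ) * h) = Real.log σ + Real.log (2 * (θ * h)) := by
    rw [← Real.log_mul (by positivity) (by positivity)]; ring_nf
  have hquad : (y - x) ^ 2 / (2 * (θ * σ) * h) * (1 - θ * h) ≤
      ((x - Real.exp (-θ * h) * y) ^ 2 + (y - Real.exp (-θ * h) * x) ^ 2)
        / (σ * (1 - Real.exp (-(2 * (θ * h))))) / 2 := by
    rw [pair_quadratic_eq, div_div, div_mul_eq_mul_div]
    have hρ : 1 - θ * h ≤ Real.exp (-θ * h) := by
      have := Real.add_one_le_exp (-θ * h); linarith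
    have hle : (1 - Real.exp (-(2 * (θ * h)))) ≤ 2 * (θ * h) := one_sub_exp_le _
    have hρ0 := Real.exp_pos (-θ * h)
    calc (y - x) ^ 2 * (1 - θ * h) / (2 * (θ * σ) * h)
        ≤ (y - x) ^ 2 * Real.exp (-θ * h) / (2 * (θ * σ) * h) := by gcongr
      _ = (y - x) ^ 2 * Real.exp (-θ * h) / (σ * (2 * (θ * h))) := by ring_nf
      _ ≤ (y - x) ^ 2 * Real.exp (-θ * h) / (σ * (1 - Real.exp (-(2 * (θ * h))))) := by gcongr
      _ = 2 * Real.exp (-θ * h) * (y - x) ^ 2 / (σ * (1 - Real.exp (-(2 * (θ * h)))) * 2) := by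
          field_simp
      _ ≤ _ := by
          gcongr
          have : 0 ≤ (1 - Real.exp (-θ * h)) ^ 2 * (x ^ 2 + y ^ 2) := by positivity
          linarith
  have hl := log_two_mul_sub_le_log_one_sub_exp hu
  simp only [pairCriterion, exp_neg_two_mul_mul]
  rw [hlog]
  linarith

/-- Applied at the fixed parameter ψ₀. The increment term needs no correction because 2u e^{-u} ≤ 1
- e^{-2u}; the remainder is controlled by (1 - ρ)²/(1 - ρ²) = (1 - ρ)/(1 + ρ) ≤ θh. -/
lemma pairCriterion_le (hh : 0 < h) (h1 : 0 < ψ.1) (h2 : 0 < ψ.2) :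
    pairCriterion h x y ψ / 2 ≤ Real.log (2 * (ψ.1 * ψ.2) * h)
      + (y - x) ^ 2 / (2 * (ψ.1 * ψ.2) * h) + ψ.1 / (2 * ψ.2) * (h * (x ^ 2 + y ^ 2)) := by
  obtain ⟨θ, σ⟩ := ψ
  simp only at h1 h2
  have hu : 0 < θ * h := mul_pos h1 hh
  have hq : 0 < 1 - Real.exp (-(2 * (θ * h))) := one_sub_exp_pos (by positivity)
  have hlog : Real.log (2 * (θ * σ) * h) = Real.log σ + Real.log (2 * (θ * h)) := by
    rw [← Real.log_mul (by positivity) (by positivity)]; ring_nf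
  have hl : Real.log (1 - Real.exp (-(2 * (θ * h)))) ≤ Real.log (2 * (θ * h)) :=
    Real.log_le_log hq (one_sub_exp_le _)
  have hA : 2 * Real.exp (-θ * h) * (y - x) ^ 2 / (σ * (1 - Real.exp (-(2 * (θ * h))))) / 2
      ≤ (y - x) ^ 2 / (2 * (θ * σ) * h) := by
    have hb := two_mul_exp_neg_le_one_sub_exp hu.le
    rw [← neg_mul] at hb
    rw [div_div, div_le_div_iff₀ (by positivity) (by positivity)]
    calc 2 * Real.exp (-θ * h) * (y - x) ^ 2 * (2 * (θ * σ) * h)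
        = (2 * (y - x) ^ 2 * σ) * (2 * (θ * h) * Real.exp (-θ * h)) := by ring
      _ ≤ (2 * (y - x) ^ 2 * σ) * (1 - Real.exp (-(2 * (θ * h)))) := by gcongr
      _ = _ := by ring
  have hB : (1 - Real.exp (-θ * h)) ^ 2 * (x ^ 2 + y ^ 2)
      / (σ * (1 - Real.exp (-(2 * (θ * h))))) / 2 ≤ θ / (2 * σ) * (h * (x ^ 2 + y ^ 2)) := by
    have hf : 1 - Real.exp (-(2 * (θ * h))) =
        (1 - Real.exp (-θ * h)) * (1 + Real.exp (-θ * h)) := by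
      have : Real.exp (-(2 * (θ * h))) = Real.exp (-θ * h) * Real.exp (-θ * h) := by
        rw [← Real.exp_add]; ring_nf
      rw [this]; ring
    have hr : 0 < 1 - Real.exp (-θ * h) := by
      rw [neg_mul]; exact one_sub_exp_pos hu
    have hr' : 1 - Real.exp (-θ * h) ≤ θ * h := by
      rw [neg_mul]; exact one_sub_exp_le _
    have hr0 := Real.exp_pos (-θ * h)
    rw [hf]
    calc (1 - Real.exp (-θ * h)) ^ 2 * (x ^ 2 + y ^ 2)
      / (σ * ((1 - Real.exp (-θ * h)) * (1 + Real.exp (-θ * h)))) / 2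
        = (1 - Real.exp (-θ * h)) * (x ^ 2 + y ^ 2) / (σ * (1 + Real.exp (-θ * h))) / 2 := by
          field_simp
      _ ≤ (θ * h) * (x ^ 2 + y ^ 2) / (σ * 1) / 2 := by
          gcongr
          linarith
      _ = _ := by field_simp
  simp only [pairCriterion, exp_neg_two_mul_mul]
  rw [hlog, pair_quadratic_eq, add_div _ _ (σ * _)]
  linarith

/-- The quadratic term is discarded and the logarithms are monotone in both parameters. The bound is
uniform in θ ≥ B, which rules out escape of the scale to infinity. -/
lemma le_pairCriterion_of_ge {B c : ℝ} (hh : 0 < h) (hB : 0 < B) (hc : 0 < c) (h1 : B ≤ ψ.1)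
    (h2 : c ≤ ψ.2) :
    Real.log (2 * (B * c) * h) - B * h ≤ pairCriterion h x y ψ / 2 := by
  obtain ⟨θ, σ⟩ := ψ
  simp only at h1 h2
  have hu : 0 < B * h := mul_pos hB hh
  have hσ : 0 < σ := hc.trans_le h2
  have hθ : 0 < θ := hB.trans_le h1
  have hq : 0 < 1 - Real.exp (-(2 * (B * h))) := one_sub_exp_pos (by positivity)
  have hlog : Real.log (2 * (B * c) * h) = Real.log c + Real.log (2 * (B * h)) := by
    rw [← Real.log_mul (by positivity) (by positivity)]; ring_nf
  have hl := log_two_mul_sub_le_log_one_sub_exp hu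
  have hl2 : Real.log (1 - Real.exp (-(2 * (B * h)))) ≤ Real.log (1 - Real.exp (-(2 * (θ * h)))) :=
    Real.log_le_log hq (by gcongr)
  have hl3 : Real.log c ≤ Real.log σ := Real.log_le_log hc h2
  have hq2 : 0 < 1 - Real.exp (-(2 * (θ * h))) := one_sub_exp_pos (by positivity)
  have : 0 ≤ ((x - Real.exp (-θ * h) * y) ^ 2 + (y - Real.exp (-θ * h) * x) ^ 2)
        / (σ * (1 - Real.exp (-(2 * (θ * h))))) := by positivity
  simp only [pairCriterion, exp_neg_two_mul_mul]
  rw [hlog]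
  linarith

/-- The squared increment, normalized by its leading-order variance, is close to the squared
innovation. -/
lemma abs_sq_increment_sub_sq_le {θ v ξ δ : ℝ} (hθ : 0 < θ) (hv : 0 < v) (hh : 0 < h) (hδ : 0 < δ)
    (hξ : y - Real.exp (-θ * h) * x = √(v * (1 - Real.exp (-2 * θ * h))) * ξ) :
    |(y - x) ^ 2 / (2 * (θ * v) * h) - ξ ^ 2| ≤
      δ * ξ ^ 2 + θ * (h * ξ ^ 2) + (1 + 1 / δ) * (θ / (2 * v)) * (h * x ^ 2) := by
  have hu : 0 < θ * h := mul_pos hθ hh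
  have hq : 0 < 1 - Real.exp (-(2 * (θ * h))) := one_sub_exp_pos (by positivity)
  -- The normalized increment is αξ - β: α is the ratio of the exact to the leading-order standard
  -- deviation, and β is the drift (1 - e^{-θh})x after normalization.
  set α : ℝ := √((1 - Real.exp (-(2 * (θ * h)))) / (2 * (θ * h))) with hα
  set β : ℝ := (1 - Real.exp (-θ * h)) * x / √(2 * (θ * v) * h) with hβ
  have hα2 : α ^ 2 = (1 - Real.exp (-(2 * (θ * h)))) / (2 * (θ * h)) :=
    Real.sq_sqrt (by positivity)
  have hα1 : α ^ 2 ≤ 1 := by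
    rw [hα2, div_le_one (by positivity)]
    exact one_sub_exp_le _
  have hα0 : 1 - θ * h ≤ α ^ 2 := by
    rw [hα2, le_div_iff₀ (by positivity)]
    have h3 := two_mul_exp_neg_le_one_sub_exp hu.le
    have h4 := Real.add_one_le_exp (-(θ * h))
    nlinarith
  have hβ2 : β ^ 2 ≤ θ / (2 * v) * (h * x ^ 2) := by
    rw [hβ, div_pow, mul_pow, Real.sq_sqrt (by positivity), div_le_iff₀ (by positivity)]
    have hr : 0 < 1 - Real.exp (-θ * h) := by
      rw [neg_mul]; exact one_sub_exp_pos hu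
    have hr' : 1 - Real.exp (-θ * h) ≤ θ * h := by
      rw [neg_mul]; exact one_sub_exp_le _
    calc (1 - Real.exp (-θ * h)) ^ 2 * x ^ 2 ≤ (θ * h) ^ 2 * x ^ 2 := by gcongr
      _ = _ := by field_simp
  have hY : (y - x) ^ 2 / (2 * (θ * v) * h) = (α * ξ - β) ^ 2 := by
    have hk : √(v * (1 - Real.exp (-2 * θ * h))) = α * √(2 * (θ * v) * h) := by
      rw [hα, ← Real.sqrt_mul (by positivity), exp_neg_two_mul_mul]
      congr 1
      field_simp
    have hs : √(2 * (θ * v) * h) ≠ 0 := by positivity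
    have hyx : y - x = (α * ξ - β) * √(2 * (θ * v) * h) := by
      rw [sub_mul, hβ, div_mul_cancel₀ _ hs]
      rw [hk] at hξ
      linarith
    rw [hyx, mul_pow, Real.sq_sqrt (by positivity)]
    field_simp
  -- Weighted AM-GM; δ stays free so that the δξ² term can be made small after averaging.
  have hcross : |2 * (α * ξ) * β| ≤ δ * ξ ^ 2 + 1 / δ * β ^ 2 := by
    have h5 : δ * (1 / δ) = 1 := by field_simp
    have h6 : 0 < 1 / δ := by positivity
    have h7 : (α * ξ) ^ 2 ≤ ξ ^ 2 := by
      rw [mul_pow]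
      nlinarith [sq_nonneg ξ]
    have h8 : ∀ a b : ℝ, 2 * a * b ≤ δ * a ^ 2 + 1 / δ * b ^ 2 := by
      intro a b
      have : 0 ≤ δ * (a - 1 / δ * b) ^ 2 := by positivity
      have h9 : δ * (a - 1 / δ * b) ^ 2 = δ * a ^ 2 - 2 * (δ * (1 / δ)) * a * b
          + (δ * (1 / δ)) * (1 / δ) * b ^ 2 := by ring
      rw [h9, h5] at this
      linarith
    rw [abs_le]
    constructor
    · have := h8 (α * ξ) (-β)
      nlinarith
    · have := h8 (α * ξ) β
      nlinarith
  have habs := abs_le.1 hcross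
  have h10 : 0 < 1 + 1 / δ := by positivity
  have hb := mul_le_mul_of_nonneg_left hβ2 h10.le
  have hξ2 : (1 - θ * h) * ξ ^ 2 ≤ α ^ 2 * ξ ^ 2 := by gcongr
  have hξ3 : α ^ 2 * ξ ^ 2 ≤ 1 * ξ ^ 2 := by gcongr
  have hξ4 : 0 ≤ θ * (h * ξ ^ 2) := by positivity
  rw [hY, abs_le]
  constructor <;> nlinarith [sq_nonneg β]

end Pair

/-! ### Sums weighted by gaps -/

section Lag

/-- The sum telescopes to the k values of g from index m on minus its first k values; no
monotonicity is used. -/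
lemma sum_gap_le {g : ℕ → ℝ} (h0 : ∀ i, 0 ≤ g i) (h1 : ∀ i, g i ≤ 1) (m k : ℕ) :
    ∑ i ∈ Finset.range m, (g (i + k) - g i) ≤ k := by
  have h2 := Finset.sum_range_add g m k
  have h3 := Finset.sum_range_add g k m
  rw [Finset.sum_sub_distrib]
  have h4 : ∑ i ∈ Finset.range k, g (m + i) ≤ k := by
    refine (Finset.sum_le_sum fun i _ => h1 (m + i)).trans ?_
    simp
  have h5 : 0 ≤ ∑ i ∈ Finset.range k, g i := Finset.sum_nonneg fun i _ => h0 i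
  rw [add_comm k m] at h3
  simp only [add_comm k] at h3
  linarith

/-- Bounded total weight times a uniform o(n) bound is o(n). This takes the place of any regularity
of the design. -/
lemma tendsto_weighted_sum_div_zero {I : ℕ → Finset ℕ} {h f : ℕ → ℕ → ℝ} {C : ℝ}
    (hh : ∀ n, ∀ i ∈ I n, 0 ≤ h n i) (hC : ∀ n, ∑ i ∈ I n, h n i ≤ C)
    (hf0 : ∀ n i, 0 ≤ f n i)
    (hf : ∀ ε : ℝ, 0 < ε → ∀ᶠ n : ℕ in atTop, ∀ i ∈ I n, f n i ≤ ε * n) :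
    Tendsto (fun n : ℕ => (∑ i ∈ I n, h n i * f n i) / (n : ℝ)) atTop (𝓝 0) := by
  have hC0 : 0 ≤ C := (Finset.sum_nonneg (hh 0)).trans (hC 0)
  rw [Metric.tendsto_atTop]
  intro ε hε
  -- Using C + 1 avoids division by zero and makes the final inequality strict.
  obtain ⟨N, hN⟩ := eventually_atTop.1 (hf (ε / (C + 1)) (by positivity))
  refine ⟨N + 1, fun n hn => ?_⟩
  have hn0 : (0 : ℝ) < n := by exact_mod_cast (by omega : 0 < n)
  have hnn : 0 ≤ ∑ i ∈ I n, h n i * f n i :=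
    Finset.sum_nonneg fun i hi => mul_nonneg (hh n i hi) (hf0 n i)
  rw [Real.dist_eq, sub_zero, abs_of_nonneg (by positivity), div_lt_iff₀ hn0]
  calc ∑ i ∈ I n, h n i * f n i ≤ ∑ i ∈ I n, h n i * (ε / (C + 1) * n) :=
        Finset.sum_le_sum fun i hi =>
          mul_le_mul_of_nonneg_left (hN n (by omega) i hi) (hh n i hi)
    _ = (∑ i ∈ I n, h n i) * (ε / (C + 1) * n) := by rw [Finset.sum_mul]
    _ ≤ C * (ε / (C + 1) * n) := by
        gcongr
        exact hC n
    _ < ε * n := by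
        have : C * (ε / (C + 1)) < ε := by
          rw [mul_div_assoc', div_lt_iff₀ (by positivity)]
          nlinarith
        nlinarith

end Lag

/-! ### Stability of the limiting minimization problem -/

/-- From log v = 2 log √v ≤ 2(√v - 1). It converts a small excess over the minimum into closeness of
√v to 1. -/
lemma sq_sqrt_sub_one_le {v : ℝ} (hv : 0 < v) : (√v - 1) ^ 2 ≤ v - 1 - Real.log v := by
  have h1 : Real.log v = 2 * Real.log (√v) := by rw [Real.log_sqrt hv.le]; ring
  have h2 := Real.log_le_sub_one_of_pos (Real.sqrt_pos.2 hv)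
  have h3 := Real.sq_sqrt hv.le
  nlinarith

/-- The sublevel sets of `x ↦ m log x + p / x` at a level tending to the minimum shrink to `{1}`
when `m` and `p` have the same positive limit. -/
lemma eventually_sublevel_near_one {M p R : ℕ → ℝ} {W : ℝ} (hW : 0 < W)
    (hM : Tendsto M atTop (𝓝 W)) (hp : Tendsto p atTop (𝓝 W)) (hR : Tendsto R atTop (𝓝 W))
    {η : ℝ} (hη : 0 < η) :
    ∀ᶠ n in atTop, ∀ x : ℝ, 0 < x → M n * Real.log x + p n / x - R n ≤ 0 → |x - 1| < η := by
  have hcont : ContinuousAt (fun q : ℝ × ℝ => q.1 / q.2 ^ 2) (1, 1) :=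
    ContinuousAt.div (by fun_prop) (by fun_prop) (by norm_num)
  obtain ⟨τ, hτ, hball⟩ := Metric.continuousAt_iff.1 hcont η hη
  have hκ : Tendsto (fun n => p n / M n) atTop (𝓝 1) := by
    rw [← div_self hW.ne']
    exact hp.div hM hW.ne'
  have hδ : Tendsto (fun n => R n / M n - Real.log (p n / M n) - 1) atTop (𝓝 0) := by
    have h1 : Tendsto (fun n => R n / M n) atTop (𝓝 1) := by
      rw [← div_self hW.ne']
      exact hR.div hM hW.ne'
    simpa using (h1.sub (hκ.log one_ne_zero)).sub_const 1
  filter_upwards [hM.eventually_const_lt hW, hp.eventually_const_lt hW,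
    hδ.eventually_lt_const (pow_pos hτ 2), Metric.tendsto_nhds.1 hκ τ hτ]
    with n hMn hpn hδn hκn x hx hle
  -- The exact minimizer of M log x + p/x is κ = p/M. In terms of v = κ/x the hypothesis reads v - 1
  -- - log v ≤ R/M - log κ - 1, whose right side tends to 0; then x = κ/(√v)² is near 1.
  set κ := p n / M n with hκdef
  have hκ0 : 0 < κ := div_pos hpn hMn
  have hv : 0 < κ / x := div_pos hκ0 hx
  have hlog : Real.log x = Real.log κ - Real.log (κ / x) := by
    rw [Real.log_div hκ0.ne' hx.ne']; ring
  have hle' : Real.log x + κ / x ≤ R n / M n := by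
    rw [le_div_iff₀ hMn]
    have : κ / x * M n = p n / x := by rw [hκdef]; field_simp
    nlinarith
  have hsq : (√(κ / x) - 1) ^ 2 < τ ^ 2 := by
    have := sq_sqrt_sub_one_le hv
    linarith
  have habs : |√(κ / x) - 1| < τ := abs_lt_of_sq_lt_sq hsq hτ.le
  have hres := hball (x := (κ, √(κ / x))) (by
    rw [Prod.dist_eq, max_lt_iff]
    exact ⟨hκn, by rwa [Real.dist_eq]⟩)
  rw [Real.dist_eq] at hres
  simp only [Real.sq_sqrt hv.le, one_pow, div_one, div_div_cancel₀ hκ0.ne'] at hres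
  exact hres

/-! ### Limits along one lag -/

/-- The squared increment of `z` over the lag-`k` gap after the `i`-th site, divided by the
leading-order term of its variance for an Ornstein-Uhlenbeck process. -/
noncomputable def scaledSqIncrement (G : ℝ) (T : ℕ → unitInterval) (z : unitInterval → ℝ)
    (k i : ℕ) : ℝ :=
  (z (T (i + k)) - z (T i)) ^ 2 / (2 * G * ((T (i + k) : ℝ) - T i))

section LagLimits

variable {T : ℕ → ℕ → unitInterval} {z : unitInterval → ℝ} {θ v : ℝ} {k : ℕ}

lemma gap_pos (hT : ∀ n, StrictMonoOn (T n) (Iio n)) (hk : 0 < k) {n i : ℕ}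
    (hi : i ∈ Finset.range (n - k)) : 0 < (T n (i + k) : ℝ) - T n i := by
  have hi' := Finset.mem_range.1 hi
  exact sub_pos.2 (hT n (mem_Iio.2 (by omega)) (mem_Iio.2 (by omega)) (by omega))

lemma sum_site_gap_le (n k : ℕ) :
    ∑ i ∈ Finset.range (n - k), ((T n (i + k) : ℝ) - T n i) ≤ k :=
  sum_gap_le (fun i => (T n i).2.1) (fun i => (T n i).2.2) _ _

lemma tendsto_sum_gap_mul_div {f : ℕ → ℕ → ℝ} (hT : ∀ n, StrictMonoOn (T n) (Iio n)) (hk : 0 < k)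
    (hf0 : ∀ n i, 0 ≤ f n i)
    (hf : ∀ ε : ℝ, 0 < ε → ∀ᶠ n : ℕ in atTop, ∀ i ∈ Finset.range (n - k), f n i ≤ ε * n) :
    Tendsto (fun n : ℕ => (∑ i ∈ Finset.range (n - k), ((T n (i + k) : ℝ) - T n i) * f n i)
      / (n : ℝ)) atTop (𝓝 0) :=
  tendsto_weighted_sum_div_zero (fun _ _ hi => (gap_pos hT hk hi).le)
    (fun n => sum_site_gap_le n k) hf0 hf

lemma tendsto_sum_gap_div (hT : ∀ n, StrictMonoOn (T n) (Iio n)) (hk : 0 < k) :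
    Tendsto (fun n : ℕ => (∑ i ∈ Finset.range (n - k), ((T n (i + k) : ℝ) - T n i))
      / (n : ℝ)) atTop (𝓝 0) := by
  have h := tendsto_sum_gap_mul_div (k := k) (f := fun _ _ => 1) hT hk
    (fun _ _ => zero_le_one) (fun ε hε => by
      filter_upwards [tendsto_natCast_atTop_atTop.eventually_ge_atTop (1 / ε)] with n hn i _
      rw [div_le_iff₀ hε] at hn
      linarith)
  simpa using h

lemma tendsto_sum_gap_mul_sq_div (hT : ∀ n, StrictMonoOn (T n) (Iio n)) (hk : 0 < k)
    (hz : ∀ ε : ℝ, 0 < ε → ∀ᶠ n : ℕ in atTop, ∀ i ∈ Finset.range n, z (T n i) ^ 2 ≤ ε * n) :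
    Tendsto (fun n : ℕ => (∑ i ∈ Finset.range (n - k), ((T n (i + k) : ℝ) - T n i) *
      (z (T n i) ^ 2 + z (T n (i + k)) ^ 2)) / (n : ℝ)) atTop (𝓝 0) := by
  refine tendsto_sum_gap_mul_div (f := fun n i => z (T n i) ^ 2 + z (T n (i + k)) ^ 2) hT hk
    (fun _ i => by positivity) fun ε hε => ?_
  filter_upwards [hz (ε / 2) (by linarith)] with n hn i hi
  have hi' := Finset.mem_range.1 hi
  have h1 := hn i (Finset.mem_range.2 (by omega))
  have h2 := hn (i + k) (Finset.mem_range.2 (by omega))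
  linarith

/-- By `abs_sq_increment_sub_sq_le` the scaled squared increments differ from ξ² by δξ² plus
gap-weighted terms that average to zero. The second limit handles the correction to the 1/x term. -/
lemma tendsto_sum_scaledSqIncrement (hθ : 0 < θ) (hv : 0 < v)
    (hT : ∀ n, StrictMonoOn (T n) (Iio n)) (hk : 0 < k)
    (hz : ∀ ε : ℝ, 0 < ε → ∀ᶠ n : ℕ in atTop, ∀ i ∈ Finset.range n, z (T n i) ^ 2 ≤ ε * n)
    (hξmax : ∀ ε : ℝ, 0 < ε → ∀ᶠ n : ℕ in atTop, ∀ i ∈ Finset.range (n - k),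
      innovation θ v z (T n i, T n (i + k)) ^ 2 ≤ ε * n)
    (hξ : Tendsto (fun n : ℕ => (∑ i ∈ Finset.range (n - k),
      innovation θ v z (T n i, T n (i + k)) ^ 2) / (n : ℝ)) atTop (𝓝 1)) :
    Tendsto (fun n : ℕ => (∑ i ∈ Finset.range (n - k), scaledSqIncrement (θ * v) (T n) z k i)
      / (n : ℝ)) atTop (𝓝 1) ∧
    Tendsto (fun n : ℕ => (∑ i ∈ Finset.range (n - k), ((T n (i + k) : ℝ) - T n i) *
      scaledSqIncrement (θ * v) (T n) z k i) / (n : ℝ)) atTop (𝓝 0) := by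
  set ξ : ℕ → ℕ → ℝ := fun n i => innovation θ v z (T n i, T n (i + k)) with hξdef
  set g : ℕ → ℕ → ℝ := fun n i => (T n (i + k) : ℝ) - T n i with hg
  set Y : ℕ → ℕ → ℝ := fun n i => scaledSqIncrement (θ * v) (T n) z k i with hY
  have hgpos : ∀ n, ∀ i ∈ Finset.range (n - k), 0 < g n i := fun n i hi => gap_pos hT hk hi
  have hpair : ∀ δ : ℝ, 0 < δ → ∀ n, ∀ i ∈ Finset.range (n - k), |Y n i - ξ n i ^ 2| ≤
      δ * ξ n i ^ 2 + θ * (g n i * ξ n i ^ 2)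
        + (1 + 1 / δ) * (θ / (2 * v)) * (g n i * z (T n i) ^ 2) := by
    intro δ hδ n i hi
    refine abs_sq_increment_sub_sq_le hθ hv (hgpos n i hi) hδ ?_
    have hpos : 0 < v * (1 - Real.exp (-2 * θ * g n i)) := by
      rw [exp_neg_two_mul_mul]
      exact mul_pos hv (one_sub_exp_pos (by have := hgpos n i hi; positivity))
    have hs := (Real.sqrt_pos.2 hpos).ne'
    simp only [hξdef, innovation]
    rw [mul_div_cancel₀ _ hs]
  have hS1 : Tendsto (fun n : ℕ => (∑ i ∈ Finset.range (n - k), g n i * ξ n i ^ 2) / (n : ℝ))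
      atTop (𝓝 0) :=
    tendsto_sum_gap_mul_div hT hk (fun n i => sq_nonneg _) hξmax
  have hS2 : Tendsto (fun n : ℕ => (∑ i ∈ Finset.range (n - k), g n i * z (T n i) ^ 2) / (n : ℝ))
      atTop (𝓝 0) :=
    tendsto_sum_gap_mul_div hT hk (fun n i => sq_nonneg (z (T n i))) fun ε hε =>
      (hz ε hε).mono fun n hn i hi => hn i (Finset.mem_range.2 (by
        have := Finset.mem_range.1 hi
        omega))
  constructor
  · rw [Metric.tendsto_nhds]
    intro ε hε
    -- Taking δ = ε/2 makes the total error tend to ε/2 < ε.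
    have hbound : Tendsto (fun n : ℕ =>
        (ε / 2) * ((∑ i ∈ Finset.range (n - k), ξ n i ^ 2) / (n : ℝ))
        + θ * ((∑ i ∈ Finset.range (n - k), g n i * ξ n i ^ 2) / (n : ℝ))
        + (1 + 1 / (ε / 2)) * (θ / (2 * v)) *
          ((∑ i ∈ Finset.range (n - k), g n i * z (T n i) ^ 2) / (n : ℝ))
        + |(∑ i ∈ Finset.range (n - k), ξ n i ^ 2) / (n : ℝ) - 1|) atTop (𝓝 (ε / 2)) := by
      have h := (((hξ.const_mul (ε / 2)).add (hS1.const_mul θ)).add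
        (hS2.const_mul ((1 + 1 / (ε / 2)) * (θ / (2 * v))))).add (hξ.sub_const 1).abs
      simpa using h
    filter_upwards [hbound.eventually_lt_const (by linarith : ε / 2 < ε)] with n hn
    rw [Real.dist_eq]
    refine lt_of_le_of_lt ?_ hn
    have hdiff : |(∑ i ∈ Finset.range (n - k), Y n i) / (n : ℝ)
        - (∑ i ∈ Finset.range (n - k), ξ n i ^ 2) / (n : ℝ)| ≤
        (ε / 2) * ((∑ i ∈ Finset.range (n - k), ξ n i ^ 2) / (n : ℝ))
        + θ * ((∑ i ∈ Finset.range (n - k), g n i * ξ n i ^ 2) / (n : ℝ))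
        + (1 + 1 / (ε / 2)) * (θ / (2 * v)) *
          ((∑ i ∈ Finset.range (n - k), g n i * z (T n i) ^ 2) / (n : ℝ)) := by
      rw [← sub_div, ← Finset.sum_sub_distrib, abs_div, Nat.abs_cast]
      calc |∑ i ∈ Finset.range (n - k), (Y n i - ξ n i ^ 2)| / (n : ℝ)
          ≤ (∑ i ∈ Finset.range (n - k), ((ε / 2) * ξ n i ^ 2 + θ * (g n i * ξ n i ^ 2)
            + (1 + 1 / (ε / 2)) * (θ / (2 * v)) * (g n i * z (T n i) ^ 2))) / (n : ℝ) := by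
            gcongr
            exact (Finset.abs_sum_le_sum_abs _ _).trans
              (Finset.sum_le_sum fun i hi => hpair (ε / 2) (by linarith) n i hi)
        _ = _ := by
            rw [Finset.sum_add_distrib, Finset.sum_add_distrib, ← Finset.mul_sum,
              ← Finset.mul_sum, ← Finset.mul_sum]
            ring
    exact (abs_sub_le _ _ _).trans (add_le_add hdiff le_rfl)
  · have hbound : Tendsto (fun n : ℕ =>
        (2 + θ) * ((∑ i ∈ Finset.range (n - k), g n i * ξ n i ^ 2) / (n : ℝ))
        + (θ / v) * ((∑ i ∈ Finset.range (n - k), g n i * z (T n i) ^ 2) / (n : ℝ)))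
        atTop (𝓝 0) := by
      simpa using (hS1.const_mul (2 + θ)).add (hS2.const_mul (θ / v))
    refine squeeze_zero (fun n => ?_) (fun n => ?_) hbound
    · refine div_nonneg (Finset.sum_nonneg fun i hi => ?_) (Nat.cast_nonneg n)
      have := hgpos n i hi
      have hY0 : 0 ≤ Y n i := by
        simp only [hY, scaledSqIncrement]
        have : 0 < (T n (i + k) : ℝ) - T n i := this
        positivity
      exact mul_nonneg this.le hY0
    · calc (∑ i ∈ Finset.range (n - k), g n i * Y n i) / (n : ℝ)
          ≤ (∑ i ∈ Finset.range (n - k), ((2 + θ) * (g n i * ξ n i ^ 2)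
            + (θ / v) * (g n i * z (T n i) ^ 2))) / (n : ℝ) := by
            gcongr with i hi
            have h0 := hgpos n i hi
            -- For the gap-weighted sum a crude bound suffices: δ = 1 and gaps at most 1 bound Y by
            -- a multiple of ξ² plus a multiple of z², and the outer gap weight gives decay.
            have h1 : g n i ≤ 1 := by
              have h2 := (T n (i + k)).2.2
              have h3 := (T n i).2.1
              simp only [hg]
              linarith
            have h2 := (abs_le.1 (hpair 1 one_pos n i hi)).2
            have h3 : Y n i ≤ 2 * ξ n i ^ 2 + θ * (1 * ξ n i ^ 2)
                + (1 + 1 / 1) * (θ / (2 * v)) * (1 * z (T n i) ^ 2) := by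
              have h4 : θ * (g n i * ξ n i ^ 2) ≤ θ * (1 * ξ n i ^ 2) := by gcongr
              have h5 : (1 + 1 / 1) * (θ / (2 * v)) * (g n i * z (T n i) ^ 2) ≤
                (1 + 1 / 1) * (θ / (2 * v)) * (1 * z (T n i) ^ 2) := by gcongr
              linarith
            refine (mul_le_mul_of_nonneg_left h3 h0.le).trans (le_of_eq ?_)
            field_simp
            ring
        _ = _ := by
            rw [Finset.sum_add_distrib, ← Finset.mul_sum, ← Finset.mul_sum]
            ring

end LagLimits

/-! ### Comparison with the equivalent parameter -/

section PairDifference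

variable {h x y G B c : ℝ} {ψ ψ₀ : ℝ × ℝ}

/-- Both bounds contain log(2Gh), unbounded as h → 0; it cancels in the difference, leaving log x +
Y/x - Y and errors with a factor h. -/
lemma le_pairCriterion_sub (hh : 0 < h) (hG : 0 < G) (h1 : 0 < ψ.1) (h2 : 0 < ψ.2)
    (h01 : 0 < ψ₀.1) (h02 : 0 < ψ₀.2) (h0 : ψ₀.1 * ψ₀.2 = G) (hB : ψ.1 ≤ B) :
    Real.log (ψ.1 * ψ.2 / G) - B * h
      + ((y - x) ^ 2 / (2 * G * h) - B * (h * ((y - x) ^ 2 / (2 * G * h)))) / (ψ.1 * ψ.2 / G)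
      - ((y - x) ^ 2 / (2 * G * h)) - ψ₀.1 / (2 * ψ₀.2) * (h * (x ^ 2 + y ^ 2))
      ≤ (pairCriterion h x y ψ - pairCriterion h x y ψ₀) / 2 := by
  have hlo := le_pairCriterion (x := x) (y := y) hh h1 h2
  have hup := pairCriterion_le (x := x) (y := y) hh h01 h02
  rw [h0] at hup
  have hlog : Real.log (2 * (ψ.1 * ψ.2) * h) =
      Real.log (ψ.1 * ψ.2 / G) + Real.log (2 * G * h) := by
    rw [← Real.log_mul (by positivity) (by positivity)]
    congr 1
    field_simp
  have hY : ((y - x) ^ 2 / (2 * G * h) - B * (h * ((y - x) ^ 2 / (2 * G * h))))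
      / (ψ.1 * ψ.2 / G) = (y - x) ^ 2 / (2 * (ψ.1 * ψ.2) * h) * (1 - B * h) := by
    field_simp
  have hle : (y - x) ^ 2 / (2 * (ψ.1 * ψ.2) * h) * (1 - B * h) ≤
      (y - x) ^ 2 / (2 * (ψ.1 * ψ.2) * h) * (1 - ψ.1 * h) := by gcongr
  have hle2 : ψ.1 * h ≤ B * h := by gcongr
  rw [hY]
  rw [hlog] at hlo
  linarith

lemma le_pairCriterion_sub_of_ge (hh : 0 < h) (hG : 0 < G) (hB : 0 < B) (hc : 0 < c)
    (h1 : B ≤ ψ.1) (h2 : c ≤ ψ.2) (h01 : 0 < ψ₀.1) (h02 : 0 < ψ₀.2) (h0 : ψ₀.1 * ψ₀.2 = G) :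
    Real.log (B * c / G) - B * h
      - ((y - x) ^ 2 / (2 * G * h)) - ψ₀.1 / (2 * ψ₀.2) * (h * (x ^ 2 + y ^ 2))
      ≤ (pairCriterion h x y ψ - pairCriterion h x y ψ₀) / 2 := by
  have hlo := le_pairCriterion_of_ge (x := x) (y := y) hh hB hc h1 h2
  have hup := pairCriterion_le (x := x) (y := y) hh h01 h02
  rw [h0] at hup
  have hlog : Real.log (2 * (B * c) * h) =
      Real.log (B * c / G) + Real.log (2 * G * h) := by
    rw [← Real.log_mul (by positivity) (by positivity)]
    congr 1
    field_simp
  rw [hlog] at hlo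
  linarith

end PairDifference

/-! ### Rewriting the criterion as a sum over lags -/

section Reindexing

/-- Extension by `0` of a finite family of sites to all indices. -/
noncomputable def extendSites {n : ℕ} (s : Fin n → unitInterval) (i : ℕ) : unitInterval :=
  if h : i < n then s ⟨i, h⟩ else 0

lemma extendSites_val {n : ℕ} (s : Fin n → unitInterval) (i : Fin n) :
    extendSites s i = s i := by
  simp [extendSites]

lemma strictMonoOn_extendSites {n : ℕ} {s : Fin n → unitInterval} (hs : StrictMono s) :
    StrictMonoOn (extendSites s) (Iio n) := by
  intro i hi j hj hij
  simp only [mem_Iio] at hi hj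
  simp only [extendSites, hi, hj, dif_pos]
  exact hs hij

/-- Pairs are grouped by k = j - i and zero weights dropped. Finiteness of the support of w enters
here, so that limits need only be taken for finitely many lags. -/
lemma sum_lt_eq_sum_lag (w : ℕ → ℝ) (S : Finset ℕ) (hS : ∀ k, k ∈ S ↔ 1 ≤ k ∧ w k ≠ 0)
    (g : ℕ → ℕ → ℝ) (n : ℕ) :
    ∑ i ∈ Finset.range n, ∑ j ∈ Finset.range n, (if i < j then w (j - i) * g i j else 0) =
      ∑ k ∈ S, w k * ∑ i ∈ Finset.range (n - k), g i (i + k) := by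
  have hR : ∑ k ∈ S, w k * ∑ i ∈ Finset.range (n - k), g i (i + k) =
      ∑ i ∈ Finset.range n, ∑ k ∈ S, if i + k < n then w k * g i (i + k) else 0 := by
    rw [Finset.sum_comm]
    refine Finset.sum_congr rfl fun k _ => ?_
    rw [Finset.mul_sum, ← Finset.sum_filter]
    refine Finset.sum_congr ?_ fun _ _ => rfl
    ext i
    simp only [Finset.mem_range, Finset.mem_filter]
    omega
  rw [hR]
  refine Finset.sum_congr rfl fun i _ => ?_
  rw [← Finset.sum_filter, ← Finset.sum_filter]
  have hL : ∑ j ∈ (Finset.range n).filter (fun j => i < j), w (j - i) * g i j =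
      ∑ j ∈ ((Finset.range n).filter (fun j => i < j)).filter (fun j => w (j - i) ≠ 0),
        w (j - i) * g i j := by
    refine (Finset.sum_filter_of_ne fun j _ hne => ?_).symm
    exact left_ne_zero_of_mul hne
  rw [hL]
  refine Finset.sum_nbij' (fun j => j - i) (fun k => i + k) ?_ ?_ ?_ ?_ ?_
  · intro j hj
    simp only [Finset.mem_filter, Finset.mem_range] at hj
    simp only [Finset.mem_filter, hS]
    exact ⟨⟨by omega, hj.2⟩, by omega⟩
  · intro k hk
    simp only [Finset.mem_filter, hS] at hk
    simp only [Finset.mem_filter, Finset.mem_range, Nat.add_sub_cancel_left]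
    exact ⟨⟨hk.2, by omega⟩, hk.1.2⟩
  · intro j hj
    simp only [Finset.mem_filter, Finset.mem_range] at hj
    omega
  · intro k _
    simp
  · intro j hj
    simp only [Finset.mem_filter, Finset.mem_range] at hj
    rw [Nat.add_sub_cancel' hj.1.2.le]

lemma condLogLik_add_swap (z : unitInterval → ℝ) {s t : unitInterval} (hst : s < t) (ψ : ℝ × ℝ) :
    condLogLik z t s ψ + condLogLik z s t ψ =
      pairCriterion ((t : ℝ) - s) (z s) (z t) ψ := by
  have h : (0 : ℝ) < t - s := sub_pos.2 hst
  simp only [condLogLik, pairCriterion, abs_sub_comm (s : ℝ) t, abs_of_pos h]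
  ring

/-- The weighted pairwise criterion as a sum over lags. -/
lemma pairCondLogLik_eq_sum_lag (w : ℕ → ℝ) (S : Finset ℕ)
    (hS : ∀ k, k ∈ S ↔ 1 ≤ k ∧ w k ≠ 0) {n : ℕ} {s : Fin n → unitInterval} (hs : StrictMono s)
    (z : unitInterval → ℝ) (ψ : ℝ × ℝ) :
    pairCondLogLik w s z ψ = ∑ k ∈ S, w k * ∑ i ∈ Finset.range (n - k),
      pairCriterion ((extendSites s (i + k) : ℝ) - extendSites s i) (z (extendSites s i))
        (z (extendSites s (i + k))) ψ := by
  set f : ℕ → ℕ → ℝ := fun i j => condLogLik z (extendSites s j) (extendSites s i) ψ with hf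
  have h1 : pairCondLogLik w s z ψ = ∑ i ∈ Finset.range n, ∑ j ∈ Finset.range n,
      (if j ≠ i then w (Nat.dist i j) * f i j else 0) := by
    rw [pairCondLogLik, Finset.sum_range]
    refine Finset.sum_congr rfl fun i _ => ?_
    rw [Finset.sum_range, Finset.sum_filter]
    refine Finset.sum_congr rfl fun j _ => ?_
    simp only [hf, extendSites_val, ne_eq, Fin.ext_iff]
  have h2 : ∀ i j, (if j ≠ i then w (Nat.dist i j) * f i j else 0) =
      (if i < j then w (j - i) * f i j else 0) + (if j < i then w (i - j) * f i j else 0) := by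
    intro i j
    rcases lt_trichotomy i j with h | h | h
    · simp [h, h.ne', h.not_gt, Nat.dist_eq_sub_of_le h.le]
    · simp [h]
    · simp [h, h.ne, h.not_gt, Nat.dist_eq_sub_of_le_right h.le]
  rw [h1]
  simp only [h2, Finset.sum_add_distrib]
  rw [Finset.sum_comm (f := fun i j => if j < i then w (i - j) * f i j else 0),
    sum_lt_eq_sum_lag w S hS f, sum_lt_eq_sum_lag w S hS (fun i j => f j i),
    ← Finset.sum_add_distrib]
  refine Finset.sum_congr rfl fun k hk => ?_
  rw [← mul_add, ← Finset.sum_add_distrib]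
  congr 1
  refine Finset.sum_congr rfl fun i hi => ?_
  have hi' := Finset.mem_range.1 hi
  have hk1 := ((hS k).1 hk).1
  exact condLogLik_add_swap z (strictMonoOn_extendSites hs (mem_Iio.2 (by omega))
    (mem_Iio.2 (by omega)) (by omega)) ψ

end Reindexing

/-! ### Existence of minimizers -/

lemma continuousOn_pairCriterion {h : ℝ} (hh : 0 < h) (x y : ℝ) :
    ContinuousOn (pairCriterion h x y) {ψ | 0 < ψ.1 ∧ 0 < ψ.2} := by
  have hpos : ∀ ψ ∈ {ψ : ℝ × ℝ | 0 < ψ.1 ∧ 0 < ψ.2}, 0 < 1 - Real.exp (-2 * ψ.1 * h) := by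
    intro ψ hψ
    rw [exp_neg_two_mul_mul]
    exact one_sub_exp_pos (by have := hψ.1; positivity)
  refine ContinuousOn.add (ContinuousOn.mul continuousOn_const (ContinuousOn.add ?_ ?_)) ?_
  · exact ContinuousOn.log (by fun_prop) fun ψ hψ => hψ.2.ne'
  · exact ContinuousOn.log (by fun_prop) fun ψ hψ => (hpos ψ hψ).ne'
  · exact ContinuousOn.div (by fun_prop) (by fun_prop)
      fun ψ hψ => (mul_pos hψ.2 (hpos ψ hψ)).ne'

/-- A minimizer over `J` exists as soon as a compact part of `J` contains a nonempty sublevel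
set. -/
lemma exists_forall_le_of_sublevel_subset {f : ℝ × ℝ → ℝ} {J Q : Set (ℝ × ℝ)} (hQ : IsCompact Q)
    (hQJ : Q ⊆ J) (hf : ContinuousOn f Q) {ψ₀ : ℝ × ℝ} (hψ₀ : ψ₀ ∈ J)
    (hsub : ∀ ψ ∈ J, f ψ ≤ f ψ₀ → ψ ∈ Q) :
    ∃ ψ, ψ ∈ J ∧ ∀ φ ∈ J, f ψ ≤ f φ := by
  have h0 : ψ₀ ∈ Q := hsub ψ₀ hψ₀ le_rfl
  obtain ⟨ψ, hψ, hmin⟩ := hQ.exists_isMinOn ⟨ψ₀, h0⟩ hf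
  refine ⟨ψ, hQJ hψ, fun φ hφ => ?_⟩
  rcases le_total (f φ) (f ψ₀) with h | h
  · exact hmin (hsub φ hφ h)
  · exact (hmin h0).trans h

/-! ### Localization of sublevel sets -/

/-- The contribution of all pairs of sites at lag `k` to the criterion. -/
noncomputable def lagCriterion (T : ℕ → unitInterval) (z : unitInterval → ℝ) (n k : ℕ)
    (ψ : ℝ × ℝ) : ℝ :=
  ∑ i ∈ Finset.range (n - k),
    pairCriterion ((T (i + k) : ℝ) - T i) (z (T i)) (z (T (i + k))) ψ

section LagDifference

variable {T : ℕ → ℕ → unitInterval} {z : unitInterval → ℝ} {G B c : ℝ} {ψ ψ₀ : ℝ × ℝ} {n k : ℕ}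

lemma le_lagCriterion_sub (hT : ∀ n, StrictMonoOn (T n) (Iio n)) (hk : 0 < k) (hG : 0 < G)
    (h1 : 0 < ψ.1) (h2 : 0 < ψ.2) (h01 : 0 < ψ₀.1) (h02 : 0 < ψ₀.2) (h0 : ψ₀.1 * ψ₀.2 = G)
    (hB : ψ.1 ≤ B) :
    ((n - k : ℕ) : ℝ) * Real.log (ψ.1 * ψ.2 / G)
      + (∑ i ∈ Finset.range (n - k), scaledSqIncrement G (T n) z k i
        - B * ∑ i ∈ Finset.range (n - k), ((T n (i + k) : ℝ) - T n i) *
          scaledSqIncrement G (T n) z k i) / (ψ.1 * ψ.2 / G)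
      - (∑ i ∈ Finset.range (n - k), scaledSqIncrement G (T n) z k i
        + ψ₀.1 / (2 * ψ₀.2) * ∑ i ∈ Finset.range (n - k), ((T n (i + k) : ℝ) - T n i) *
          (z (T n i) ^ 2 + z (T n (i + k)) ^ 2)
        + B * ∑ i ∈ Finset.range (n - k), ((T n (i + k) : ℝ) - T n i))
      ≤ (lagCriterion (T n) z n k ψ - lagCriterion (T n) z n k ψ₀) / 2 := by
  have h := Finset.sum_le_sum fun i (hi : i ∈ Finset.range (n - k)) =>
    le_pairCriterion_sub (x := z (T n i)) (y := z (T n (i + k))) (gap_pos hT hk hi) hG h1 h2 h01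
      h02 h0 hB
  simp only [Finset.sum_sub_distrib, Finset.sum_add_distrib, ← Finset.mul_sum, ← Finset.sum_div,
    Finset.sum_const, Finset.card_range, nsmul_eq_mul] at h
  simp only [lagCriterion, scaledSqIncrement, Finset.sum_sub_distrib]
  linarith

lemma le_lagCriterion_sub_of_ge (hT : ∀ n, StrictMonoOn (T n) (Iio n)) (hk : 0 < k) (hG : 0 < G)
    (hB : 0 < B) (hc : 0 < c) (h1 : B ≤ ψ.1) (h2 : c ≤ ψ.2) (h01 : 0 < ψ₀.1) (h02 : 0 < ψ₀.2)
    (h0 : ψ₀.1 * ψ₀.2 = G) :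
    ((n - k : ℕ) : ℝ) * Real.log (B * c / G)
      - (∑ i ∈ Finset.range (n - k), scaledSqIncrement G (T n) z k i
        + ψ₀.1 / (2 * ψ₀.2) * ∑ i ∈ Finset.range (n - k), ((T n (i + k) : ℝ) - T n i) *
          (z (T n i) ^ 2 + z (T n (i + k)) ^ 2)
        + B * ∑ i ∈ Finset.range (n - k), ((T n (i + k) : ℝ) - T n i))
      ≤ (lagCriterion (T n) z n k ψ - lagCriterion (T n) z n k ψ₀) / 2 := by
  have h := Finset.sum_le_sum fun i (hi : i ∈ Finset.range (n - k)) =>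
    le_pairCriterion_sub_of_ge (x := z (T n i)) (y := z (T n (i + k))) (gap_pos hT hk hi) hG hB hc
      h1 h2 h01 h02 h0
  simp only [Finset.sum_sub_distrib, ← Finset.mul_sum, ← Finset.sum_div, Finset.sum_const, Finset.card_range,
    nsmul_eq_mul] at h
  simp only [lagCriterion, scaledSqIncrement, Finset.sum_sub_distrib]
  linarith

end LagDifference

/-- For a realization `z` obeying the law of large numbers for its innovations, every parameter
with a criterion not exceeding that of the equivalent parameter `ψ₀` eventually has a bounded
scale and an almost correct microergodic parameter. -/
lemma eventually_sublevel_near {T : ℕ → ℕ → unitInterval} {z : unitInterval → ℝ} {θ v : ℝ}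
    (hθ : 0 < θ) (hv : 0 < v) (hT : ∀ n, StrictMonoOn (T n) (Iio n))
    {w : ℕ → ℝ} {S : Finset ℕ} (hS1 : ∀ k ∈ S, 0 < k) (hSw : ∀ k ∈ S, 0 < w k) (hSne : S.Nonempty)
    (hz : ∀ ε : ℝ, 0 < ε → ∀ᶠ n : ℕ in atTop, ∀ i ∈ Finset.range n, z (T n i) ^ 2 ≤ ε * n)
    (hξmax : ∀ k ∈ S, ∀ ε : ℝ, 0 < ε → ∀ᶠ n : ℕ in atTop, ∀ i ∈ Finset.range (n - k),
      innovation θ v z (T n i, T n (i + k)) ^ 2 ≤ ε * n)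
    (hξ : ∀ k ∈ S, Tendsto (fun n : ℕ => (∑ i ∈ Finset.range (n - k),
      innovation θ v z (T n i, T n (i + k)) ^ 2) / (n : ℝ)) atTop (𝓝 1))
    {ψ₀ : ℝ × ℝ} (h01 : 0 < ψ₀.1) (h02 : 0 < ψ₀.2) (h0 : ψ₀.1 * ψ₀.2 = θ * v)
    {B c η : ℝ} (hB : 0 < B) (hc : 0 < c) (hBc : 1 < Real.log (B * c / (θ * v))) (hη : 0 < η) :
    ∀ᶠ n : ℕ in atTop, ∀ ψ : ℝ × ℝ, 0 < ψ.1 → 0 < ψ.2 → (ψ.1 ≤ B ∨ c ≤ ψ.2) →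
      ∑ k ∈ S, w k * lagCriterion (T n) z n k ψ ≤ ∑ k ∈ S, w k * lagCriterion (T n) z n k ψ₀ →
      ψ.1 ≤ B ∧ |ψ.1 * ψ.2 / (θ * v) - 1| < η := by
  set G := θ * v with hGdef
  have hG : 0 < G := mul_pos hθ hv
  set W := ∑ k ∈ S, w k with hWdef
  have hW : 0 < W := Finset.sum_pos hSw hSne
  set C := ψ₀.1 / (2 * ψ₀.2) with hC
  -- M, p and R are the coefficients, per observation, of log x, 1/x and the subtracted constant in
  -- the lower bound for the criterion difference. All three tend to W.
  set M : ℕ → ℝ := fun n => ∑ k ∈ S, w k * (((n - k : ℕ) : ℝ) / n) with hM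
  set p : ℕ → ℝ := fun n => ∑ k ∈ S, w k *
    ((∑ i ∈ Finset.range (n - k), scaledSqIncrement G (T n) z k i) / (n : ℝ)
      - B * ((∑ i ∈ Finset.range (n - k), ((T n (i + k) : ℝ) - T n i) *
          scaledSqIncrement G (T n) z k i) / (n : ℝ))) with hp
  set R : ℕ → ℝ := fun n => ∑ k ∈ S, w k *
    ((∑ i ∈ Finset.range (n - k), scaledSqIncrement G (T n) z k i) / (n : ℝ)
      + C * ((∑ i ∈ Finset.range (n - k), ((T n (i + k) : ℝ) - T n i) *
          (z (T n i) ^ 2 + z (T n (i + k)) ^ 2)) / (n : ℝ))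
      + B * ((∑ i ∈ Finset.range (n - k), ((T n (i + k) : ℝ) - T n i)) / (n : ℝ))) with hR
  have hlim : ∀ f : ℕ → ℕ → ℝ, (∀ k ∈ S, Tendsto (f k) atTop (𝓝 1)) →
      Tendsto (fun n => ∑ k ∈ S, w k * f k n) atTop (𝓝 W) := by
    intro f hf
    have := tendsto_finsetSum S fun k hk => (hf k hk).const_mul (w k)
    simpa only [mul_one] using this
  have hMlim : Tendsto M atTop (𝓝 W) := hlim _ fun k _ => tendsto_natCast_sub_div k
  have hY : ∀ k ∈ S, _ := fun k hk =>
    tendsto_sum_scaledSqIncrement hθ hv hT (hS1 k hk) hz (hξmax k hk) (hξ k hk)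
  have hplim : Tendsto p atTop (𝓝 W) := hlim _ fun k hk => by
    simpa using (hY k hk).1.sub ((hY k hk).2.const_mul B)
  have hRlim : Tendsto R atTop (𝓝 W) := hlim _ fun k hk => by
    simpa using ((hY k hk).1.add ((tendsto_sum_gap_mul_sq_div hT (hS1 k hk) hz).const_mul C)).add
      ((tendsto_sum_gap_div hT (hS1 k hk)).const_mul B)
  -- Lower bound for θ ≥ B and σ² ≥ c: its limit W(log(Bc/G) - 1) is positive, contradicting
  -- membership in the sublevel set.
  have hlarge : Tendsto (fun n => M n * Real.log (B * c / G) - R n) atTop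
      (𝓝 (W * Real.log (B * c / G) - W)) := (hMlim.mul_const _).sub hRlim
  have hlarge0 : 0 < W * Real.log (B * c / G) - W := by nlinarith
  filter_upwards [eventually_sublevel_near_one hW hMlim hplim hRlim hη,
    hlarge.eventually_const_lt hlarge0, eventually_gt_atTop 0] with n hn hnl hn0 ψ h1 h2 hcase hle
  have hn0' : (0 : ℝ) < n := by exact_mod_cast hn0
  have hdiff : ∑ k ∈ S, w k * ((lagCriterion (T n) z n k ψ - lagCriterion (T n) z n k ψ₀) / 2 / n)
      ≤ 0 := by
    have he : ∑ k ∈ S, w k *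
        ((lagCriterion (T n) z n k ψ - lagCriterion (T n) z n k ψ₀) / 2 / n) =
        (∑ k ∈ S, w k * lagCriterion (T n) z n k ψ
          - ∑ k ∈ S, w k * lagCriterion (T n) z n k ψ₀) / 2 / n := by
      rw [← Finset.sum_sub_distrib, Finset.sum_div, Finset.sum_div]
      refine Finset.sum_congr rfl fun k _ => ?_
      ring
    rw [he]
    exact div_nonpos_of_nonpos_of_nonneg (by linarith) hn0'.le
  have hsmall : ψ.1 ≤ B := by
    by_contra hcon
    have hcσ : c ≤ ψ.2 := hcase.resolve_left hcon
    refine absurd hnl (not_lt.2 (le_trans ?_ hdiff))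
    rw [hM, hR, Finset.sum_mul, ← Finset.sum_sub_distrib]
    refine Finset.sum_le_sum fun k hk => ?_
    have h := div_le_div_of_nonneg_right (le_lagCriterion_sub_of_ge (z := z) (n := n) hT (hS1 k hk)
      hG hB hc (not_le.1 hcon).le hcσ h01 h02 h0) hn0'.le
    refine le_trans (le_of_eq ?_) (mul_le_mul_of_nonneg_left h (hSw k hk).le)
    ring
  refine ⟨hsmall, hn _ (by positivity) (le_trans ?_ hdiff)⟩
  rw [hM, hp, hR, Finset.sum_mul, Finset.sum_div, ← Finset.sum_add_distrib,
    ← Finset.sum_sub_distrib]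
  refine Finset.sum_le_sum fun k hk => ?_
  have h := div_le_div_of_nonneg_right (le_lagCriterion_sub (z := z) (n := n) hT (hS1 k hk)
    hG h1 h2 h01 h02 h0 hsmall) hn0'.le
  refine le_trans (le_of_eq ?_) (mul_le_mul_of_nonneg_left h (hSw k hk).le)
  ring

/-- Compact localization of the parameters in `J` with bounded scale and microergodic parameter
near `G`. -/
lemma exists_compact_localization {a b c d G B : ℝ} (ha : 0 < a) (hab : a ≤ b) (hc : 0 < c)
    (hcd : c ≤ d) (hG : 0 < G) {J : Set (ℝ × ℝ)}
    (hJ : J = Icc a b ×ˢ Icc c d ∨ J = Icc a b ×ˢ Ioi (0 : ℝ) ∨ J = Ioi (0 : ℝ) ×ˢ Icc c d) :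
    ∃ Q : Set (ℝ × ℝ), IsCompact Q ∧ Q ⊆ J ∧
      ∀ ψ ∈ J, ψ.1 ≤ B → |ψ.1 * ψ.2 / G - 1| < 1 / 2 → ψ ∈ Q := by
  have hb : 0 < b := ha.trans_le hab
  have hd : 0 < d := hc.trans_le hcd
  have hprod : ∀ ψ : ℝ × ℝ, |ψ.1 * ψ.2 / G - 1| < 1 / 2 →
      G / 2 ≤ ψ.1 * ψ.2 ∧ ψ.1 * ψ.2 ≤ 2 * G := by
    intro ψ h
    obtain ⟨h1, h2⟩ := abs_lt.1 h
    have h3 : 1 / 2 < ψ.1 * ψ.2 / G := by linarith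
    have h4 : ψ.1 * ψ.2 / G < 2 := by linarith
    rw [lt_div_iff₀ hG] at h3
    rw [div_lt_iff₀ hG] at h4
    constructor <;> linarith
  rcases hJ with rfl | rfl | rfl
  · exact ⟨_, isCompact_Icc.prod isCompact_Icc, Subset.rfl, fun ψ hψ _ _ => hψ⟩
  -- The product lies in [G/2, 2G] and θ in [a, b], which confines σ² away from 0 and ∞.
  · refine ⟨Icc a b ×ˢ Icc (G / 2 / b) (2 * G / a), isCompact_Icc.prod isCompact_Icc,
      prod_mono Subset.rfl fun σ hσ => ?_, fun ψ hψ _ h => ?_⟩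
    · exact lt_of_lt_of_le (by positivity) hσ.1
    · obtain ⟨h1, h2⟩ := hprod ψ h
      obtain ⟨hψ1, hψ2⟩ := hψ
      have hψ2' : 0 < ψ.2 := hψ2
      refine ⟨hψ1, ?_, ?_⟩
      · rw [div_le_iff₀ hb]
        nlinarith [hψ1.2]
      · rw [le_div_iff₀ ha]
        nlinarith [hψ1.1]
  -- Here the upper end of θ comes from B, and the lower end from θσ² ≥ G/2 with σ² ≤ d.
  · refine ⟨Icc (G / 2 / d) B ×ˢ Icc c d, isCompact_Icc.prod isCompact_Icc,
      prod_mono (fun τ hτ => ?_) Subset.rfl, fun ψ hψ hψB h => ?_⟩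
    · exact lt_of_lt_of_le (by positivity) hτ.1
    · obtain ⟨h1, h2⟩ := hprod ψ h
      obtain ⟨hψ1, hψ2⟩ := hψ
      have hψ1' : 0 < ψ.1 := hψ1
      refine ⟨⟨?_, hψB⟩, hψ2⟩
      rw [div_le_iff₀ hd]
      nlinarith [hψ2.2]

/-! ### Consistency -/

theorem theorem2 {Ω : Type*} [MeasurableSpace Ω] (P : Measure Ω) [IsProbabilityMeasure P]
    (θ₀ v₀ : ℝ) (hθ₀ : 0 < θ₀) (hv₀ : 0 < v₀)
    (Z : unitInterval → Ω → ℝ) (hZ : IsStationaryOU P Z θ₀ v₀)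
    (s : (n : ℕ) → Fin n → unitInterval) (hs : ∀ n, StrictMono (s n))
    (w : ℕ → ℝ) (hw_nonneg : ∀ k, 1 ≤ k → 0 ≤ w k) (hw_ne : ∃ k, 1 ≤ k ∧ w k ≠ 0)
    (hw_fin : {k | 1 ≤ k ∧ w k ≠ 0}.Finite)
    (a b c d : ℝ) (ha : 0 < a) (hab : a ≤ b) (hc : 0 < c) (hcd : c ≤ d)
    (J : Set (ℝ × ℝ))
    (hJ : J = Icc a b ×ˢ Icc c d ∨ J = Icc a b ×ˢ Ioi (0 : ℝ) ∨ J = Ioi (0 : ℝ) ×ˢ Icc c d)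
    (hJ_mem : ∃ ψ ∈ J, ψ.1 * ψ.2 = θ₀ * v₀) :
    ∀ᵐ ω ∂P,
      (∀ᶠ n in atTop, ∃ ψ, IsWPCMLE J w (s n) (fun t => Z t ω) ψ) ∧
      ∀ ψhat : ℕ → ℝ × ℝ,
        (∀ᶠ n in atTop, IsWPCMLE J w (s n) (fun t => Z t ω) (ψhat n)) →
        Tendsto (fun n => (ψhat n).1 * (ψhat n).2) atTop (𝓝 (θ₀ * v₀)) := by
  set T : ℕ → ℕ → unitInterval := fun n => extendSites (s n) with hTdef
  have hT : ∀ n, StrictMonoOn (T n) (Iio n) := fun n => strictMonoOn_extendSites (hs n)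
  set S : Finset ℕ := hw_fin.toFinset with hSdef
  have hS : ∀ k, k ∈ S ↔ 1 ≤ k ∧ w k ≠ 0 := fun k => by simp [hSdef]
  have hS1 : ∀ k ∈ S, 0 < k := fun k hk => ((hS k).1 hk).1
  have hSw : ∀ k ∈ S, 0 < w k := fun k hk =>
    lt_of_le_of_ne (hw_nonneg k ((hS k).1 hk).1) ((hS k).1 hk).2.symm
  have hSne : S.Nonempty := hw_ne.imp fun k hk => (hS k).2 hk
  have hG : 0 < θ₀ * v₀ := mul_pos hθ₀ hv₀
  obtain ⟨ψ₀, hψ₀J, hψ₀⟩ := hJ_mem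
  have hJpos : ∀ ψ ∈ J, 0 < ψ.1 ∧ 0 < ψ.2 := by
    rcases hJ with rfl | rfl | rfl <;> rintro ψ ⟨h1, h2⟩
    · exact ⟨ha.trans_le h1.1, hc.trans_le h2.1⟩
    · exact ⟨ha.trans_le h1.1, h2⟩
    · exact ⟨h1, hc.trans_le h2.1⟩
  have hJbc : ∀ ψ ∈ J, ψ.1 ≤ b ∨ c ≤ ψ.2 := by
    rcases hJ with rfl | rfl | rfl <;> rintro ψ ⟨h1, h2⟩
    · exact Or.inl h1.2
    · exact Or.inl h1.2
    · exact Or.inr h2.1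
  -- B ≥ b covers the sets J with θ ∈ [a, b]; the other entry gives log(Bc/G) ≥ 2 > 1, as needed
  -- when θ is unbounded.
  set B := max b (Real.exp 2 * (θ₀ * v₀) / c) with hBdef
  have hB : 0 < B := lt_max_of_lt_left (ha.trans_le hab)
  have hBc : 1 < Real.log (B * c / (θ₀ * v₀)) := by
    have h : Real.exp 2 ≤ B * c / (θ₀ * v₀) := by
      rw [le_div_iff₀ hG, ← div_le_iff₀ hc]
      exact le_max_right _ _
    have := Real.log_le_log (Real.exp_pos 2) h
    rw [Real.log_exp] at this
    linarith
  have hzmax : ∀ᵐ ω ∂P, ∀ ε, 0 < ε → ∀ᶠ n : ℕ in atTop, ∀ i ∈ Finset.range n,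
      (Z (T n i) ω / √v₀) ^ 2 ≤ ε * n :=
    ae_eventually_sq_le (X := fun n i ω => Z (T n i) ω / √v₀) (fun n => (Finset.card_range n).le)
      fun n i _ => hZ.isStdNormal_div_sqrt hv₀ _
  have hξmax : ∀ᵐ ω ∂P, ∀ k ∈ S, ∀ ε : ℝ, 0 < ε → ∀ᶠ n : ℕ in atTop,
      ∀ i ∈ Finset.range (n - k),
        innovation θ₀ v₀ (fun t => Z t ω) (T n i, T n (i + k)) ^ 2 ≤ ε * n := by
    refine (Finset.eventually_all S).2 fun k hk => ?_
    refine ae_eventually_sq_le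
      (X := fun n i ω => innovation θ₀ v₀ (fun t => Z t ω) (T n i, T n (i + k)))
      (fun n => by simp) fun n i hi => hZ.isStdNormal_innovation hθ₀ hv₀ ?_
    exact Subtype.coe_lt_coe.1 (sub_pos.1 (gap_pos hT (hS1 k hk) hi))
  have hξ : ∀ᵐ ω ∂P, ∀ k ∈ S, Tendsto (fun n : ℕ => (∑ i ∈ Finset.range (n - k),
      innovation θ₀ v₀ (fun t => Z t ω) (T n i, T n (i + k)) ^ 2) / (n : ℝ)) atTop (𝓝 1) :=
    (Finset.eventually_all S).2 fun k hk => hZ.ae_tendsto_sum_innovation_sq hθ₀ hv₀ hT (hS1 k hk)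
  filter_upwards [hzmax, hξmax, hξ] with ω hω1 hω2 hω3
  set z : unitInterval → ℝ := fun t => Z t ω with hzdef
  have hz : ∀ ε : ℝ, 0 < ε → ∀ᶠ n : ℕ in atTop, ∀ i ∈ Finset.range n,
      z (T n i) ^ 2 ≤ ε * n := by
    intro ε hε
    filter_upwards [hω1 (ε / v₀) (by positivity)] with n hn i hi
    have h := hn i hi
    rw [div_pow, Real.sq_sqrt hv₀.le, div_le_iff₀ hv₀] at h
    refine h.trans (le_of_eq ?_)
    field_simp
  have hcrit : ∀ n ψ, pairCondLogLik w (s n) z ψ =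
      ∑ k ∈ S, w k * lagCriterion (T n) z n k ψ := fun n ψ =>
    pairCondLogLik_eq_sum_lag w S hS (hs n) z ψ
  have hnear : ∀ η : ℝ, 0 < η → ∀ᶠ n : ℕ in atTop, ∀ ψ ∈ J,
      pairCondLogLik w (s n) z ψ ≤ pairCondLogLik w (s n) z ψ₀ →
      ψ.1 ≤ B ∧ |ψ.1 * ψ.2 / (θ₀ * v₀) - 1| < η := by
    intro η hη
    filter_upwards [eventually_sublevel_near hθ₀ hv₀ hT hS1 hSw hSne hz hω2 hω3
      (hJpos ψ₀ hψ₀J).1 (hJpos ψ₀ hψ₀J).2 hψ₀ hB hc hBc hη] with n hn ψ hψ hle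
    rw [hcrit, hcrit] at hle
    exact hn ψ (hJpos ψ hψ).1 (hJpos ψ hψ).2
      ((hJbc ψ hψ).imp_left fun h => h.trans (le_max_left _ _)) hle
  refine ⟨?_, fun ψhat hψhat => ?_⟩
  · obtain ⟨Q, hQ, hQJ, hQmem⟩ := exists_compact_localization (B := B) ha hab hc hcd hG hJ
    -- The radius 1/2 is the one required by `exists_compact_localization`.
    filter_upwards [hnear (1 / 2) (by norm_num)] with n hn
    refine exists_forall_le_of_sublevel_subset hQ hQJ ?_ hψ₀J
      fun ψ hψ hle => hQmem ψ hψ (hn ψ hψ hle).1 (hn ψ hψ hle).2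
    have hcont : ContinuousOn (fun ψ => ∑ k ∈ S, w k * lagCriterion (T n) z n k ψ) Q := by
      refine continuousOn_finsetSum _ fun k hk => ContinuousOn.mul continuousOn_const ?_
      refine continuousOn_finsetSum _ fun i hi => ?_
      exact (continuousOn_pairCriterion (gap_pos hT (hS1 k hk) hi) _ _).mono
        fun ψ hψ => hJpos ψ (hQJ hψ)
    exact hcont.congr fun ψ _ => hcrit n ψ
  · have hratio : Tendsto (fun n => (ψhat n).1 * (ψhat n).2 / (θ₀ * v₀)) atTop (𝓝 1) := by
      rw [Metric.tendsto_nhds]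
      intro η hη
      filter_upwards [hnear η hη, hψhat] with n hn hmin
      rw [Real.dist_eq]
      -- A minimizer does at least as well as ψ₀, so it lies in the sublevel set.
      exact (hn _ hmin.1 (hmin.2 ψ₀ hψ₀J)).2
    have h := hratio.mul_const (θ₀ * v₀)
    rw [one_mul] at h
    exact h.congr fun n => div_mul_cancel₀ _ hG.ne'
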